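/- Let $I\subset\mathbb R$ be an open interval symmetric about $0$, let $f:I\to\mathbb R$ be smooth, positive and even, and put $F(s)=\int_0^s f(t)\,dt$ and $\varphi=F/f$. Suppose $s_0>0$ is a first inflection point of $\log F$: $(\log F)''<0$ on $(0,s_0)$ and $(\log F)''>0$ on an interval $(s_0,s_0+\delta)\subset I$ with $\delta>0$. For $c>0$ endow $Y\times\mathbb R$, where $Y=I\times S^1$ has coordinates $(s,\theta)$ with $\theta\in\mathbb R/2\pi\mathbb Z$, with the metric $$G'_c=ds^2+c^2f(s)^2\,d\theta^2+dy^2 .$$ For $0<s_1<s_0$ let $$u_{s_1}(s)=-\int_0^s\frac{\varphi(t)\,dt}{\sqrt{\varphi(s_1)^2-\varphi(t)^2}},\qquad \tilde u_{s_1}(s)=u_{s_1}(s)-u_{s_1}(s_1)\qquad(-s_1\le s\le s_1),$$ and let $S_{s_1}=\{(s,\theta,\pm\tilde u_{s_1}(s)) : -s_1\le s\le s_1,\ \theta\in\mathbb R/2\pi\mathbb Z\}\subset Y\times\mathbb R$ be the corresponding soap bubble (a torus of constant mean curvature $1/\varphi(s_1)$ for every $G'_c$), with outer unit normal $\nu$.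 Its index form is $$Q(g)=\int_{S_{s_1}}\big(|\nabla^{S}g|^2+P\,g^2\big)\,d\,\mathrm{area},\qquad P=-\mathrm{Ric}(\nu,\nu)-|II|^2,$$ where $\nabla^S$, the Ricci tensor $\mathrm{Ric}$ of $Y\times\mathbb R$, the second fundamental form $II$ of $S_{s_1}$ and the area are taken with respect to $G'_c$. If $(\log f)''>0$ on $(-s_0,s_0)$, then there is a number $\beta>0$ (depending only on $f$ and $s_0$) such that for all $c>0$ and all $s_1\in(0,s_0)$ with $\varphi(s_1)/c>\beta$ the soap bubble $S_{s_1}$ is stable with respect to $G'_c$, in the following sense: $Q(g)>0$ for every smooth function $g:S_{s_1}\to\mathbb R$ with $\int_{S_{s_1}}g\,d\,\mathrm{area}=0$ that is not a constant multiple of $\langle\partial_y,\nu\rangle$. -/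

import Mathlib

open MeasureTheory
open scoped ContDiff Matrix

noncomputable section

/-! ### Riemannian metrics in coordinates -/

/-- The `i`-th partial derivative of `h` at `x`. -/
def partialDeriv {n : ℕ} {E : Type*} [NormedAddCommGroup E] [NormedSpace ℝ E]
    (i : Fin n) (h : (Fin n → ℝ) → E) (x : Fin n → ℝ) : E :=
  deriv (fun t : ℝ => h (Function.update x i t)) (x i)

/-- The Gram matrix `(g_{ij})` of a Riemannian metric, as a function of the coordinates. -/
abbrev MetricField (n : ℕ) := (Fin n → ℝ) → Matrix (Fin n) (Fin n) ℝ

/-- The Christoffel symbol `Γ^k_{ij}` of the Levi-Civita connection. -/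
def christoffel {n : ℕ} (G : MetricField n) (k i j : Fin n) (x : Fin n → ℝ) : ℝ :=
  (1 / 2) * ∑ l, (G x)⁻¹ k l *
    (partialDeriv i (fun z => G z j l) x + partialDeriv j (fun z => G z i l) x
      - partialDeriv l (fun z => G z i j) x)

/-- The component `R_{ij}` of the Ricci tensor (positive on round spheres). -/
def ricciTensor {n : ℕ} (G : MetricField n) (i j : Fin n) (x : Fin n → ℝ) : ℝ :=
  ∑ k, (partialDeriv k (christoffel G k i j) x - partialDeriv j (christoffel G k i k) x)
    + ∑ k, ∑ l, (christoffel G k k l x * christoffel G l i j x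
        - christoffel G k j l x * christoffel G l i k x)

/-- The inner product `⟨v, w⟩` of two vectors at the point `x`. -/
def metricInner {n : ℕ} (G : MetricField n) (x v w : Fin n → ℝ) : ℝ :=
  v ⬝ᵥ (G x *ᵥ w)

/-- `Ric(v, v)` at the point `x`. -/
def ricciQuad {n : ℕ} (G : MetricField n) (x v : Fin n → ℝ) : ℝ :=
  ∑ i, ∑ j, ricciTensor G i j x * v i * v j

/-! ### Surfaces in three-dimensional Riemannian manifolds -/

/-- A parametrized oriented piece of surface in a coordinate domain of a three-manifold: a map
`(q₀, q₁) ↦ map q`, the parameter domain on which it is considered, and a sign which selects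
one of the two unit normals. -/
structure SurfacePatch where
  map : (Fin 2 → ℝ) → (Fin 3 → ℝ)
  dom : Set (Fin 2 → ℝ)
  side : ℤˣ

namespace SurfacePatch

variable (G : MetricField 3) (X : SurfacePatch)

/-- The coordinate tangent vector `∂X/∂q_a`. -/
def tangent (a : Fin 2) (q : Fin 2 → ℝ) : Fin 3 → ℝ := partialDeriv a X.map q

/-- The first fundamental form (induced metric) `h_{ab} = ⟨∂_a X, ∂_b X⟩`. -/
def firstForm (q : Fin 2 → ℝ) : Matrix (Fin 2) (Fin 2) ℝ :=
  Matrix.of fun a b => metricInner G (X.map q) (X.tangent a q) (X.tangent b q)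

/-- The area density `√(det h)`, so that `d area = √(det h) dq₀ dq₁`. -/
def areaDensity (q : Fin 2 → ℝ) : ℝ := Real.sqrt (X.firstForm G q).det

/-- The covector `∂₀X × ∂₁X`, which annihilates the tangent plane. -/
def conormal (q : Fin 2 → ℝ) : Fin 3 → ℝ :=
  crossProduct (X.tangent 0 q) (X.tangent 1 q)

/-- The unit normal `ν` on the chosen side: the vector dual to the conormal, normalized. -/
def unitNormal (q : Fin 2 → ℝ) : Fin 3 → ℝ :=
  let N : Fin 3 → ℝ := (G (X.map q))⁻¹ *ᵥ X.conormal q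
  (((X.side : ℤ) : ℝ) / Real.sqrt (metricInner G (X.map q) N N)) • N

/-- The ambient covariant derivative `∇_{∂_a X} ∂_b X` along the surface. -/
def covDerivTangent (a b : Fin 2) (q : Fin 2 → ℝ) : Fin 3 → ℝ := fun k =>
  partialDeriv a (X.tangent b) q k
    + ∑ i, ∑ j, christoffel G k i j (X.map q) * X.tangent a q i * X.tangent b q j

/-- The second fundamental form `II_{ab} = ⟨∇_{∂_a X} ∂_b X, ν⟩`. -/
def secondForm (q : Fin 2 → ℝ) : Matrix (Fin 2) (Fin 2) ℝ :=
  Matrix.of fun a b => metricInner G (X.map q) (X.covDerivTangent G a b q) (X.unitNormal G q)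

/-- `|II|² = h^{ac} h^{bd} II_{ab} II_{cd}`. -/
def secondFormNormSq (q : Fin 2 → ℝ) : ℝ :=
  ∑ a, ∑ b, ∑ c, ∑ d, (X.firstForm G q)⁻¹ a c * (X.firstForm G q)⁻¹ b d
    * X.secondForm G q a b * X.secondForm G q c d

/-- `|∇^S u|² = h^{ab} ∂_a u ∂_b u` for the function `u` on the surface obtained by restricting
the ambient function `u`. -/
def gradNormSq (u : (Fin 3 → ℝ) → ℝ) (q : Fin 2 → ℝ) : ℝ :=
  ∑ a, ∑ b, (X.firstForm G q)⁻¹ a b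
    * partialDeriv a (fun p => u (X.map p)) q * partialDeriv b (fun p => u (X.map p)) q

/-- The potential `P = - Ric(ν, ν) - |II|²` of the index form. -/
def jacobiPotential (q : Fin 2 → ℝ) : ℝ :=
  - ricciQuad G (X.map q) (X.unitNormal G q) - X.secondFormNormSq G q

end SurfacePatch

/-- `∫_S h d area` for a surface `S` which is the disjoint union, up to a set of zero area, of
finitely many patches. The integrand is given on each patch, in the parameters. -/
def surfaceIntegral {ι : Type*} [Fintype ι] (G : MetricField 3) (S : ι → SurfacePatch)
    (h : ι → (Fin 2 → ℝ) → ℝ) : ℝ :=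
  ∑ i, ∫ q in (S i).dom, h i q * (S i).areaDensity G q

/-- The index form `Q(u) = ∫_S (|∇^S u|² + P u²) d area`. -/
def indexForm {ι : Type*} [Fintype ι] (G : MetricField 3) (S : ι → SurfacePatch)
    (u : (Fin 3 → ℝ) → ℝ) : ℝ :=
  surfaceIntegral G S fun i q =>
    (S i).gradNormSq G u q + (S i).jacobiPotential G q * u ((S i).map q) ^ 2

/-! ### The manifold `Y × ℝ` with `Y = I × S¹`, and the bubbles

Coordinates are `x 0 = s ∈ I`, `x 1 = θ`, `x 2 = y`, where `θ ∈ ℝ` is the angle modulo `2π`: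
functions on `Y × ℝ` are the functions on `I × ℝ × ℝ` that are `2π`-periodic in `θ`. -/

/-- The metric `ds² + c² f(s)² dθ² + dy²`. -/
def tubeMetric (f : ℝ → ℝ) (c : ℝ) : MetricField 3 := fun x =>
  Matrix.diagonal ![1, c ^ 2 * f (x 0) ^ 2, 1]

/-- `u` is a smooth function on `Y × ℝ = I × S¹ × ℝ`. -/
def IsSmoothOnTube (I : Set ℝ) (u : (Fin 3 → ℝ) → ℝ) : Prop :=
  ContDiffOn ℝ ∞ u {x | x 0 ∈ I} ∧
    ∀ x : Fin 3 → ℝ, x 0 ∈ I → u ![x 0, x 1 + 2 * Real.pi, x 2] = u x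

/-- `F(s) = ∫₀ˢ f`. -/
def primF (f : ℝ → ℝ) (s : ℝ) : ℝ := ∫ t in (0 : ℝ)..s, f t

/-- `φ = F / f`. -/
def phiF (f : ℝ → ℝ) (s : ℝ) : ℝ := primF f s / f s

/-- `u_{s₁}(s) = -∫₀ˢ φ / √(φ(s₁)² - φ²)`. -/
def profileU (f : ℝ → ℝ) (s₁ s : ℝ) : ℝ :=
  -∫ t in (0 : ℝ)..s, phiF f t / Real.sqrt (phiF f s₁ ^ 2 - phiF f t ^ 2)

/-- The profile function `u_{s₁}(s) - u_{s₁}(s₁)` on `[-s₁, s₁]`, which vanishes at `± s₁`. -/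
def profile (f : ℝ → ℝ) (s₁ s : ℝ) : ℝ := profileU f s₁ s - profileU f s₁ s₁

/-- The surface `S_{s₁} = {(s, θ, ± profile s) : -s₁ ≤ s ≤ s₁}`, given by its upper half
(`ε = 1`) and its lower half (`ε = -1`), each parametrized by `(s, θ)`; what is left out, the two
circles `s = ± s₁` and the curve `θ = 0`, has zero area. The unit normal is the one pointing out
of the solid torus `{|y| < profile s}`. -/
def bubble (f : ℝ → ℝ) (s₁ : ℝ) (ε : ℤˣ) : SurfacePatch where
  map q := ![q 0, q 1, ((ε : ℤ) : ℝ) * profile f s₁ (q 0)]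
  dom := {q | q 0 ∈ Set.Ioo (-s₁) s₁ ∧ q 1 ∈ Set.Ioo 0 (2 * Real.pi)}
  side := ε

/-- The coordinate vector field `∂_y`. -/
def partialY : Fin 3 → ℝ := ![0, 0, 1]

/-- Stability of `S_{s₁}` in `Y × ℝ` with the metric `ds² + c² f² dθ² + dy²`: the index form is
positive on every smooth function with zero average on `S_{s₁}` that is not a constant multiple of
`⟨∂_y, ν⟩`. As `S_{s₁}` is a compact embedded surface, its smooth functions are the restrictions
of the smooth functions `u` on `Y × ℝ`; the values of `u` off `S_{s₁}` play no role. -/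
def IsStableBubble (I : Set ℝ) (f : ℝ → ℝ) (c s₁ : ℝ) : Prop :=
  ∀ u : (Fin 3 → ℝ) → ℝ, IsSmoothOnTube I u →
    surfaceIntegral (tubeMetric f c) (bubble f s₁) (fun ε q => u ((bubble f s₁ ε).map q)) = 0 →
    (¬ ∃ k : ℝ, ∀ ε : ℤˣ, ∀ q ∈ (bubble f s₁ ε).dom,
      u ((bubble f s₁ ε).map q)
        = k * metricInner (tubeMetric f c) ((bubble f s₁ ε).map q) partialY
            ((bubble f s₁ ε).unitNormal (tubeMetric f c) q)) →
    0 < indexForm (tubeMetric f c) (bubble f s₁) u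

end

noncomputable section

open Real Set Filter Topology

/-! Write Λ = φ(s₁) and describe each half of the bubble by the angle σ ∈ [-π/2, π/2] with φ(s) = Λ
sin σ. This is a legitimate coordinate because (log F)'' < 0 means φ' > 0. It is the angle of the
normal, ν = (sin σ, 0, ± cos σ), so it removes the vertical tangents at s = ± s₁. On each half the
index form becomes c ∬ (A g_σ² + K g_θ² + V g²) dσ dθ with A = fφ'/Λ, T = fΛ/φ', K = T/(c²f²), e =
(log f)'' T and V = e sin²σ - A, while the area element is c T dσ dθ (`index_angle`,
`areaDensity_angle`).

The form splits orthogonally into the θ-means and the deviations from them. For the deviations a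
Poincaré inequality bounds the g_θ² term from below, and K/(4π²) + V > 0 as soon as Λ/c exceeds 2π
times a bound for f (`le_circleIndex`, `angular_add_V_pos`). This is where β comes from.

The θ-means form a pair of functions of σ, one for each half, and the reflections in y and in s
leave three cases. (1) The difference of the pair vanishes at ± π/2. The function cos σ, which up to
sign is the Jacobi field ⟨∂_y, ν⟩ of vertical translation, is a null solution positive inside, so
the form is nonnegative with only cos in its kernel (`dirichlet`). (2) The part of the sum that is
odd in s vanishes at 0. Comparison with sin, which solves (A sin')' = (V - e) sin, bounds the form
below by ∫ e g², and e > 0 since log f is convex (`vanishing_at_zero`). (3) The part of the sum that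
is even in s has equal values at ± π/2 and zero average. Let ψ be the normal speed of the family of
bubbles as Λ grows. Their mean curvature is 1/Λ, so ψ solves (Aψ')' = Vψ + T/Λ² with Neumann
conditions. Convexity of log f makes ψ positive. Thus ψ is orthogonal, for the form, to functions of
zero average, and the form is negative on ψ. Subtracting the multiple of ψ that matches the end
values can only lower the form and leads back to case (1) (`zero_average_of_ends_eq`). Case (1)
accounts for the null direction ⟨∂_y, ν⟩; it is the only one (`pair_nonneg`, `index_pos`). -/

/-! ### Calculus for Picone-type identities -/

/-- The quotient of the square of a function by a function with a simple zero at the same point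
is continuous there (with the convention `0 / 0 = 0`). -/
theorem continuousAt_sq_div {g w : ℝ → ℝ} {g' w' x : ℝ} (hg : HasDerivAt g g' x)
    (hw : HasDerivAt w w' x) (hgx : g x = 0) (hwx : w x = 0) (hw' : w' ≠ 0) :
    ContinuousAt (fun t => g t ^ 2 / w t) x := by
  have h1 := hg.tendsto_slope
  have h2 := hw.tendsto_slope
  -- Write g²/w = g · (g/w): the first factor tends to 0 and the second to g'/w'.
  have h3 : Tendsto (fun t => g t * (slope g x t / slope w x t)) (𝓝[≠] x)
      (𝓝 (g x * (g' / w'))) :=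
    (hg.continuousAt.tendsto.mono_left nhdsWithin_le_nhds).mul (h1.div h2 hw')
  rw [continuousAt_iff_punctured_nhds]
  simp only [hgx, hwx, zero_mul] at h3 ⊢
  simp only [ne_eq, OfNat.ofNat_ne_zero, not_false_eq_true, zero_pow, div_zero]
  refine h3.congr' ?_
  filter_upwards [self_mem_nhdsWithin] with t ht
  have ht' : t - x ≠ 0 := sub_ne_zero.2 ht
  simp only [slope_def_field, hgx, hwx, sub_zero]
  by_cases hwt : w t = 0
  · simp [hwt]
  · field_simp

/-- If `B' = Φ - R` with `R ≥ 0`, then the increment of `B` is at most `∫ Φ`, with equality only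
if `R = 0`. -/
theorem sub_le_integral_of_remainder {a b : ℝ} (hab : a ≤ b) {B Φ R : ℝ → ℝ}
    (hΦ : Continuous Φ) (hB : ContinuousOn B (Icc a b))
    (hd : ∀ x ∈ Ioo a b, HasDerivAt B (Φ x - R x) x) (hR : ∀ x ∈ Ioo a b, 0 ≤ R x) :
    B b - B a ≤ ∫ x in a..b, Φ x ∧
      (∫ x in a..b, Φ x = B b - B a → ∀ x ∈ Ioo a b, R x = 0) := by
  -- E' = R ≥ 0, so E is monotone; if it takes equal values at both ends it is constant and R
  -- vanishes.
  set E : ℝ → ℝ := fun x => (∫ t in a..x, Φ t) - B x with hE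
  have hdE : ∀ x ∈ Ioo a b, HasDerivAt E (R x) x := fun x hx => by
    have := (hΦ.integral_hasStrictDerivAt a x).hasDerivAt.sub (hd x hx)
    exact this.congr_deriv (by ring)
  have hcE : ContinuousOn E (Icc a b) :=
    (intervalIntegral.continuous_primitive
      (fun _ _ => hΦ.intervalIntegrable _ _) a).continuousOn.sub hB
  have hm : MonotoneOn E (Icc a b) := by
    refine monotoneOn_of_deriv_nonneg (convex_Icc a b) hcE ?_ ?_
    · rw [interior_Icc]
      exact fun x hx => (hdE x hx).differentiableAt.differentiableWithinAt
    · rw [interior_Icc]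
      exact fun x hx => by rw [(hdE x hx).deriv]; exact hR x hx
  have ha : a ∈ Icc a b := left_mem_Icc.2 hab
  have hb : b ∈ Icc a b := right_mem_Icc.2 hab
  have hEa : E a = - B a := by simp [hE]
  refine ⟨?_, fun heq x hx => ?_⟩
  · have := hm ha hb hab
    simp only [hEa] at this
    simp only [hE] at this
    linarith
  · have hEb : E b = E a := by rw [hEa]; simp only [hE]; linarith
    have hconst : E =ᶠ[𝓝 x] fun _ => E a := by
      filter_upwards [Ioo_mem_nhds hx.1 hx.2] with y hy
      have hy' := Ioo_subset_Icc_self hy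
      exact le_antisymm (hEb ▸ hm hy' hb hy'.2) (hm ha hy' hy'.1)
    exact (hdE x hx).unique ((hasDerivAt_const x (E a)).congr_of_eventuallyEq hconst)

/-- A continuous nonnegative function with zero integral over `[a, b]` vanishes there. -/
theorem eq_zero_of_intervalIntegral_eq_zero {a b : ℝ} (hab : a < b) {Φ : ℝ → ℝ}
    (hΦ : Continuous Φ) (h0 : ∀ x ∈ Icc a b, 0 ≤ Φ x) (hi : ∫ x in a..b, Φ x ≤ 0) :
    ∀ x ∈ Icc a b, Φ x = 0 := by
  intro x hx
  by_contra hne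
  have : 0 < ∫ x in a..b, Φ x :=
    intervalIntegral.integral_pos hab hΦ.continuousOn
      (fun y hy => h0 y (Ioc_subset_Icc_self hy)) ⟨x, hx, lt_of_le_of_ne (h0 x hx) (Ne.symm hne)⟩
  linarith

/-- The integral of an odd function over a symmetric interval. -/
theorem integral_symm_of_odd {g : ℝ → ℝ} (hg : ∀ x, g (-x) = -g x) (a : ℝ) :
    ∫ x in (-a)..a, g x = 0 := by
  have := intervalIntegral.integral_comp_neg g (a := -a) (b := a)
  simp only [hg, intervalIntegral.integral_neg, neg_neg] at this
  linarith

/-! ### The rotationally invariant problem on the profile circle -/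

/-- The data of the Sturm-Liouville problem `-(A g')' + (e sin² - A) g = λ T g` on the circle, for
which `cos` is a null solution, together with the data of a positive solution `n + cos · W` of
`(A g')' = (e sin² - A) g + k T` on `[-π/2, π/2]` with Neumann boundary conditions. -/
structure ZeroModeData where
  A : ℝ → ℝ
  e : ℝ → ℝ
  T : ℝ → ℝ
  n : ℝ → ℝ
  w : ℝ → ℝ
  W : ℝ → ℝ
  k : ℝ
  A_pos : ∀ x, 0 < A x
  e_pos : ∀ x, 0 < e x
  T_pos : ∀ x, 0 < T x
  n_pos : ∀ x, 0 < n x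
  k_pos : 0 < k
  continuous_e : Continuous e
  continuous_T : Continuous T
  continuous_w : Continuous w
  A_even : ∀ x, A (-x) = A x
  e_even : ∀ x, e (-x) = e x
  T_even : ∀ x, T (-x) = T x
  n_even : ∀ x, n (-x) = n x
  hasDerivAt_A : ∀ x, HasDerivAt A (-(e x * sin x * cos x)) x
  hasDerivAt_n : ∀ x, HasDerivAt n (w x * cos x) x
  hasDerivAt_W : ∀ x, HasDerivAt W (-w x) x
  W_nonneg : ∀ x ∈ Icc (-(π / 2)) (π / 2), 0 ≤ W x
  W_left : W (-(π / 2)) = 0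
  W_right : W (π / 2) = 0
  forced : ∀ x, A x * w x * sin x = (e x * sin x ^ 2 - A x) * n x + k * T x

namespace ZeroModeData

variable (D : ZeroModeData)

/-- The potential. -/
def V (x : ℝ) : ℝ := D.e x * sin x ^ 2 - D.A x

/-- The integrand of the quadratic form. -/
def density (g g' : ℝ → ℝ) (x : ℝ) : ℝ := D.A x * g' x ^ 2 + D.V x * g x ^ 2

theorem continuous_A : Continuous D.A :=
  continuous_iff_continuousAt.2 fun x => (D.hasDerivAt_A x).continuousAt

theorem continuous_V : Continuous D.V := by
  have := D.continuous_e
  have := D.continuous_A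
  unfold V
  fun_prop

theorem continuous_density {g g' : ℝ → ℝ} (hg : Continuous g) (hg' : Continuous g') :
    Continuous (D.density g g') := by
  have := D.continuous_V
  have := D.continuous_A
  unfold density
  fun_prop

/-- The form is positive on functions vanishing at `± π/2`, except for the multiples of `cos`. -/
theorem dirichlet {r r' : ℝ → ℝ} (hr : ∀ x, HasDerivAt r (r' x) x) (hr' : Continuous r')
    (hl : r (-(π / 2)) = 0) (hright : r (π / 2) = 0) :
    0 ≤ ∫ x in (-(π / 2))..(π / 2), D.density r r' x ∧
      (∫ x in (-(π / 2))..(π / 2), D.density r r' x = 0 →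
        ∀ x ∈ Icc (-(π / 2)) (π / 2), r x = r 0 * cos x) := by
  have hrc : Continuous r := continuous_iff_continuousAt.2 fun x => (hr x).continuousAt
  have hpi := Real.pi_pos
  -- Picone's identity with the null solution cos: the density equals B' + A (r' - (cos'/cos) r)²
  -- with B = A (cos'/cos) r². The double zero of r² beats the simple zero of cos, so B is
  -- continuous and vanishes at the ends.
  set B : ℝ → ℝ := fun x => -(D.A x * sin x) * (r x ^ 2 / cos x) with hBdef
  have hcos : ∀ x ∈ Ioo (-(π / 2)) (π / 2), cos x ≠ 0 := fun x hx => (cos_pos_of_mem_Ioo hx).ne'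
  have hAs : Continuous fun x => -(D.A x * sin x) := by
    have := D.continuous_A
    fun_prop
  have hB : ContinuousOn B (Icc (-(π / 2)) (π / 2)) := by
    intro x hx
    refine ContinuousAt.continuousWithinAt (hAs.continuousAt.mul ?_)
    rcases hx.1.eq_or_lt with rfl | h1
    · exact continuousAt_sq_div (hr _) (hasDerivAt_cos _) hl (by simp) (by simp)
    rcases hx.2.eq_or_lt with rfl | h2
    · exact continuousAt_sq_div (hr _) (hasDerivAt_cos _) hright (by simp) (by simp)
    exact (hrc.continuousAt.pow 2).div continuous_cos.continuousAt (hcos x ⟨h1, h2⟩)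
  obtain ⟨h1, h2⟩ := sub_le_integral_of_remainder (B := B) (a := -(π / 2)) (b := π / 2)
    (R := fun x => D.A x * (r' x + sin x / cos x * r x) ^ 2) (by linarith)
    (D.continuous_density hrc hr') hB
    (fun x hx => by
      have hc := hcos x hx
      have := (((D.hasDerivAt_A x).mul (hasDerivAt_sin x)).neg).mul
        (((hr x).pow 2).div (hasDerivAt_cos x) hc)
      refine this.congr_deriv ?_
      simp only [density, V, Pi.mul_apply, Pi.neg_apply, Pi.pow_apply, Pi.div_apply]
      field_simp
      simp only [Nat.cast_ofNat, Nat.add_one_sub_one, pow_one]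
      ring)
    (fun x hx => mul_nonneg (D.A_pos x).le (sq_nonneg _))
  have hBl : B (-(π / 2)) = 0 := by simp [hBdef]
  have hBr : B (π / 2) = 0 := by simp [hBdef]
  rw [hBl, hBr, sub_zero] at h1 h2
  refine ⟨h1, fun h0 => ?_⟩
  have hR := h2 h0
  have hz : ∀ x ∈ Ioo (-(π / 2)) (π / 2), r' x = -(sin x / cos x * r x) := fun x hx => by
    have := hR x hx
    have h3 := (mul_eq_zero.1 this).resolve_left (D.A_pos x).ne'
    have := pow_eq_zero_iff (two_ne_zero) |>.1 h3
    linarith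
  have hq : ∀ x ∈ Ioo (-(π / 2)) (π / 2), HasDerivAt (fun t => r t / cos t) 0 x := fun x hx => by
    have hc := hcos x hx
    refine ((hr x).div (hasDerivAt_cos x) hc).congr_deriv ?_
    rw [hz x hx]
    field_simp
    ring
  have hconst : ∀ x ∈ Ioo (-(π / 2)) (π / 2), r x / cos x = r 0 / cos 0 := fun x hx =>
    isOpen_Ioo.is_const_of_deriv_eq_zero isPreconnected_Ioo
      (fun y hy => (hq y hy).differentiableAt.differentiableWithinAt)
      (fun y hy => (hq y hy).deriv) hx ⟨by linarith, by linarith⟩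
  intro x hx
  rcases hx.1.eq_or_lt with rfl | h3
  · simp [hl]
  rcases hx.2.eq_or_lt with rfl | h4
  · simp [hright]
  have := hconst x ⟨h3, h4⟩
  rw [cos_zero, div_one, div_eq_iff (hcos x ⟨h3, h4⟩)] at this
  exact this

/-- On functions vanishing at `0` the form dominates `∫ e g²`. -/
theorem vanishing_at_zero {g g' : ℝ → ℝ} (hg : ∀ x, HasDerivAt g (g' x) x) (hg' : Continuous g')
    (h0 : g 0 = 0) :
    ∫ x in (-(π / 2))..(π / 2), D.e x * g x ^ 2 ≤
      ∫ x in (-(π / 2))..(π / 2), D.density g g' x := by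
  have hgc : Continuous g := continuous_iff_continuousAt.2 fun x => (hg x).continuousAt
  have hpi := Real.pi_pos
  have he := D.continuous_e
  -- Picone's identity with sin, for which (A sin')' = (V - e) sin. Since sin vanishes at 0, each
  -- half of the interval is treated separately; B vanishes at 0 because g does, and at ± π/2
  -- because cos does.
  set B : ℝ → ℝ := fun x => (D.A x * cos x) * (g x ^ 2 / sin x) with hBdef
  have hsin : ∀ x ∈ Icc (-(π / 2)) (π / 2), x ≠ 0 → sin x ≠ 0 := fun x hx hx0 hs => by
    rcases lt_or_gt_of_ne hx0 with h | h
    · exact (sin_neg_of_neg_of_neg_pi_lt h (by linarith [hx.1])).ne hs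
    · exact (sin_pos_of_pos_of_lt_pi h (by linarith [hx.2])).ne' hs
  have hAc : Continuous fun x => D.A x * cos x := by
    have := D.continuous_A
    fun_prop
  have hB : ContinuousOn B (Icc (-(π / 2)) (π / 2)) := by
    intro x hx
    refine ContinuousAt.continuousWithinAt (hAc.continuousAt.mul ?_)
    by_cases hx0 : x = 0
    · subst hx0
      exact continuousAt_sq_div (hg _) (hasDerivAt_sin _) h0 (by simp) (by simp)
    exact (hgc.continuousAt.pow 2).div continuous_sin.continuousAt (hsin x hx hx0)
  have hcont : Continuous fun x => D.density g g' x - D.e x * g x ^ 2 := by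
    have := D.continuous_density hgc hg'
    fun_prop
  have key : ∀ x ∈ Icc (-(π / 2)) (π / 2), x ≠ 0 → HasDerivAt B
      ((D.density g g' x - D.e x * g x ^ 2) - D.A x * (g' x - cos x / sin x * g x) ^ 2) x := by
    intro x hx hx0
    have hc := hsin x hx hx0
    have := ((D.hasDerivAt_A x).mul (hasDerivAt_cos x)).mul
        (((hg x).pow 2).div (hasDerivAt_sin x) hc)
    refine this.congr_deriv ?_
    simp only [density, V, Pi.mul_apply, Pi.pow_apply, Pi.div_apply]
    field_simp
    simp only [Nat.cast_ofNat, Nat.add_one_sub_one, pow_one]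
    linear_combination (-(D.e x * sin x ^ 2 * g x ^ 2)) * sin_sq_add_cos_sq x
  have hpos : ∀ x, 0 ≤ D.A x * (g' x - cos x / sin x * g x) ^ 2 :=
    fun x => mul_nonneg (D.A_pos x).le (sq_nonneg _)
  have hright := (sub_le_integral_of_remainder (B := B) (a := 0) (b := π / 2) (by linarith) hcont
    (hB.mono (Icc_subset_Icc (by linarith) le_rfl))
    (fun x hx => key x ⟨by linarith [hx.1], hx.2.le⟩ hx.1.ne') (fun x _ => hpos x)).1
  have hleft := (sub_le_integral_of_remainder (B := B) (a := -(π / 2)) (b := 0) (by linarith) hcont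
    (hB.mono (Icc_subset_Icc le_rfl (by linarith)))
    (fun x hx => key x ⟨hx.1.le, by linarith [hx.2]⟩ hx.2.ne) (fun x _ => hpos x)).1
  have hsum := intervalIntegral.integral_add_adjacent_intervals
    (hcont.intervalIntegrable (μ := volume) (-(π / 2)) 0)
    (hcont.intervalIntegrable (μ := volume) 0 (π / 2))
  have hBl : B (-(π / 2)) = 0 := by simp [hBdef]
  have hBr : B (π / 2) = 0 := by simp [hBdef]
  have hsub := intervalIntegral.integral_sub (μ := volume) (a := -(π / 2)) (b := π / 2)
    ((D.continuous_density hgc hg').intervalIntegrable _ _)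
    (Continuous.intervalIntegrable (u := fun x => D.e x * g x ^ 2) (by fun_prop) _ _)
  linarith

/-- A solution of `(A ψ')' = V ψ + k T`. -/
def ψ (x : ℝ) : ℝ := D.n x + cos x * D.W x

theorem continuous_W : Continuous D.W :=
  continuous_iff_continuousAt.2 fun x => (D.hasDerivAt_W x).continuousAt

/-- The contributions of w from n' and W' cancel. What is left vanishes at ± π/2 together with W,
which gives the Neumann conditions. -/
theorem hasDerivAt_ψ (x : ℝ) : HasDerivAt D.ψ (-(D.W x * sin x)) x := by
  refine ((D.hasDerivAt_n x).add ((hasDerivAt_cos x).mul (D.hasDerivAt_W x))).congr_deriv ?_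
  ring

/-- As cos is a null solution, the terms in W combine to V cos W; the remaining term A w sin is what
`forced` prescribes. -/
theorem hasDerivAt_A_mul_ψ' (x : ℝ) :
    HasDerivAt (fun x => D.A x * -(D.W x * sin x)) (D.V x * D.ψ x + D.k * D.T x) x := by
  refine ((D.hasDerivAt_A x).mul
    (((D.hasDerivAt_W x).mul (hasDerivAt_sin x)).neg)).congr_deriv ?_
  have := D.forced x
  simp only [V, ψ, Pi.mul_apply, Pi.neg_apply]
  linear_combination this

theorem continuous_ψ : Continuous D.ψ :=
  continuous_iff_continuousAt.2 fun x => (D.hasDerivAt_ψ x).continuousAt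

theorem ψ_pos {x : ℝ} (hx : x ∈ Icc (-(π / 2)) (π / 2)) : 0 < D.ψ x :=
  add_pos_of_pos_of_nonneg (D.n_pos x) (mul_nonneg (cos_nonneg_of_mem_Icc hx) (D.W_nonneg x hx))

/-- The weak form of the equation for `ψ`. -/
theorem integral_ψ_mul {p p' : ℝ → ℝ} (hp : ∀ x, HasDerivAt p (p' x) x) (hp' : Continuous p') :
    ∫ x in (-(π / 2))..(π / 2), (D.A x * -(D.W x * sin x) * p' x + D.V x * D.ψ x * p x) =
      -(D.k * ∫ x in (-(π / 2))..(π / 2), D.T x * p x) := by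
  have hpc : Continuous p := continuous_iff_continuousAt.2 fun x => (hp x).continuousAt
  have hA := D.continuous_A
  have hV := D.continuous_V
  have hW := D.continuous_W
  have hT := D.continuous_T
  have hψ := D.continuous_ψ
  have hd : ∀ x, HasDerivAt (fun x => D.A x * -(D.W x * sin x) * p x)
      ((D.A x * -(D.W x * sin x) * p' x + D.V x * D.ψ x * p x) + D.k * (D.T x * p x)) x :=
    fun x => ((D.hasDerivAt_A_mul_ψ' x).mul (hp x)).congr_deriv (by ring)
  have h := intervalIntegral.integral_eq_sub_of_hasDerivAt (a := -(π / 2)) (b := π / 2)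
    (fun x _ => hd x) (Continuous.intervalIntegrable (by fun_prop) _ _)
  rw [intervalIntegral.integral_add (Continuous.intervalIntegrable (by fun_prop) _ _)
    (Continuous.intervalIntegrable (by fun_prop) _ _), intervalIntegral.integral_const_mul,
    D.W_left, D.W_right] at h
  linarith

theorem integral_T_mul_pos {p : ℝ → ℝ} (hp : Continuous p)
    (h : ∀ x ∈ Ioo (-(π / 2)) (π / 2), 0 < p x) :
    0 < ∫ x in (-(π / 2))..(π / 2), D.T x * p x :=
  intervalIntegral.intervalIntegral_pos_of_pos_on
    ((D.continuous_T.mul hp).intervalIntegrable _ _) (fun x hx => mul_pos (D.T_pos x) (h x hx))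
    (by linarith [Real.pi_pos])

/-- The form is positive definite on functions of zero average with equal values at `± π/2`. -/
theorem zero_average_of_ends_eq {p p' : ℝ → ℝ} (hp : ∀ x, HasDerivAt p (p' x) x) (hp' : Continuous p')
    (hends : p (-(π / 2)) = p (π / 2)) (havg : ∫ x in (-(π / 2))..(π / 2), D.T x * p x = 0) :
    0 ≤ ∫ x in (-(π / 2))..(π / 2), D.density p p' x ∧
      (∫ x in (-(π / 2))..(π / 2), D.density p p' x = 0 →
        ∀ x ∈ Icc (-(π / 2)) (π / 2), p x = 0) := by
  have hpi := Real.pi_pos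
  have hpc : Continuous p := continuous_iff_continuousAt.2 fun x => (hp x).continuousAt
  have hA := D.continuous_A
  have hV := D.continuous_V
  have hW := D.continuous_W
  have hψ := D.continuous_ψ
  have hψends : D.ψ (-(π / 2)) = D.ψ (π / 2) := by
    simp [ψ, D.n_even]
  have hψr := D.ψ_pos (x := π / 2) ⟨by linarith, le_rfl⟩
  -- With this multiple, p - tψ vanishes at both ends and `dirichlet` applies.
  set t : ℝ := p (π / 2) / D.ψ (π / 2) with ht
  set ψ' : ℝ → ℝ := fun x => -(D.W x * sin x) with hψ'
  have hψ'c : Continuous ψ' := by fun_prop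
  have hd : ∀ x, HasDerivAt (fun x => p x - t * D.ψ x) (p' x - t * ψ' x) x :=
    fun x => (hp x).sub ((D.hasDerivAt_ψ x).const_mul t)
  have hright : p (π / 2) - t * D.ψ (π / 2) = 0 := by
    rw [ht]; field_simp; ring
  obtain ⟨h1, h2⟩ := D.dirichlet hd (by fun_prop) (by rw [hends, hψends, hright]) hright
  have e1 := D.integral_ψ_mul hp hp'
  have e2 := D.integral_ψ_mul D.hasDerivAt_ψ hψ'c
  have hTψ := D.integral_T_mul_pos hψ fun x hx => D.ψ_pos (Ioo_subset_Icc_self hx)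
  rw [havg, mul_zero, neg_zero] at e1
  -- The zero average makes ψ orthogonal to p for the form, and the form at ψ is -k ∫ Tψ < 0, so
  -- removing tψ lowers the form by t² k ∫ Tψ.
  have hQ : ∫ x in (-(π / 2))..(π / 2), D.density p p' x =
      (∫ x in (-(π / 2))..(π / 2),
        D.density (fun x => p x - t * D.ψ x) (fun x => p' x - t * ψ' x) x) +
        t ^ 2 * (D.k * ∫ x in (-(π / 2))..(π / 2), D.T x * D.ψ x) := by
    have hdec : ∀ x, D.density p p' x =
        D.density (fun x => p x - t * D.ψ x) (fun x => p' x - t * ψ' x) x +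
        (2 * t * (D.A x * ψ' x * p' x + D.V x * D.ψ x * p x) -
          t ^ 2 * (D.A x * ψ' x * ψ' x + D.V x * D.ψ x * D.ψ x)) := fun x => by
      simp only [density]; ring
    simp_rw [hdec]
    rw [intervalIntegral.integral_add
      ((D.continuous_density (by fun_prop) (by fun_prop)).intervalIntegrable _ _)
      (Continuous.intervalIntegrable (by fun_prop) _ _),
      intervalIntegral.integral_sub (Continuous.intervalIntegrable (by fun_prop) _ _)
      (Continuous.intervalIntegrable (by fun_prop) _ _), intervalIntegral.integral_const_mul,
      intervalIntegral.integral_const_mul, e1, e2]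
    ring
  have hpos := mul_pos D.k_pos hTψ
  have hnn := mul_nonneg (sq_nonneg t) hpos.le
  refine ⟨by linarith, fun h0 => ?_⟩
  have ht0 : t = 0 := by
    have : t ^ 2 * (D.k * ∫ x in (-(π / 2))..(π / 2), D.T x * D.ψ x) = 0 := by linarith
    exact pow_eq_zero_iff two_ne_zero |>.1 ((mul_eq_zero.1 this).resolve_right hpos.ne')
  have hp0 := h2 (by linarith)
  simp only [ht0, zero_mul, sub_zero] at hp0
  -- A multiple of cos has nonzero average unless it is zero, so no null direction survives here.
  have hcos := D.integral_T_mul_pos continuous_cos fun x hx => cos_pos_of_mem_Ioo hx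
  have : ∫ x in (-(π / 2))..(π / 2), D.T x * p x =
      p 0 * ∫ x in (-(π / 2))..(π / 2), D.T x * cos x := by
    rw [← intervalIntegral.integral_const_mul]
    refine intervalIntegral.integral_congr fun x hx => ?_
    rw [uIcc_of_le (by linarith)] at hx
    simp only [hp0 x hx]
    ring
  rw [havg] at this
  have h00 := (mul_eq_zero.1 this.symm).resolve_right hcos.ne'
  intro x hx
  rw [hp0 x hx, h00, zero_mul]

theorem V_even (x : ℝ) : D.V (-x) = D.V x := by simp [V, D.e_even, D.A_even]

/-- Functions of zero weighted average with no condition at `± π/2`, split by parity. -/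
theorem zero_average {p p' : ℝ → ℝ} (hp : ∀ x, HasDerivAt p (p' x) x) (hp' : Continuous p')
    (havg : ∫ x in (-(π / 2))..(π / 2), D.T x * p x = 0) :
    0 ≤ ∫ x in (-(π / 2))..(π / 2), D.density p p' x ∧
      (∫ x in (-(π / 2))..(π / 2), D.density p p' x = 0 →
        ∀ x ∈ Icc (-(π / 2)) (π / 2), p x = 0) := by
  have hpi := Real.pi_pos
  have hpc : Continuous p := continuous_iff_continuousAt.2 fun x => (hp x).continuousAt
  have hA := D.continuous_A
  have hV := D.continuous_V
  have hT := D.continuous_T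
  have hec := D.continuous_e
  have hneg : ∀ x, HasDerivAt (fun x => p (-x)) (-p' (-x)) x := fun x => by
    exact ((hp (-x)).comp x (hasDerivAt_neg x)).congr_deriv (by ring)
  -- The even part u carries the whole average and has equal end values; the odd part v vanishes at
  -- 0. All coefficients are even, so the cross terms integrate to zero.
  set u : ℝ → ℝ := fun x => (p x + p (-x)) / 2 with hu
  set u' : ℝ → ℝ := fun x => (p' x - p' (-x)) / 2 with hu'
  set v : ℝ → ℝ := fun x => (p x - p (-x)) / 2 with hv
  set v' : ℝ → ℝ := fun x => (p' x + p' (-x)) / 2 with hv'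
  have hud : ∀ x, HasDerivAt u (u' x) x := fun x =>
    (((hp x).add (hneg x)).div_const 2).congr_deriv (by simp only [hu']; ring)
  have hvd : ∀ x, HasDerivAt v (v' x) x := fun x =>
    (((hp x).sub (hneg x)).div_const 2).congr_deriv (by simp only [hv']; ring)
  have huc : Continuous u := by fun_prop
  have hvc : Continuous v := by fun_prop
  have huc' : Continuous u' := by fun_prop
  have hvc' : Continuous v' := by fun_prop
  have huavg : ∫ x in (-(π / 2))..(π / 2), D.T x * u x = 0 := by
    have h1 : ∀ x, D.T x * p x = D.T x * u x + D.T x * v x := fun x => by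
      simp only [hu, hv]; ring
    simp_rw [h1] at havg
    rw [intervalIntegral.integral_add (Continuous.intervalIntegrable (by fun_prop) _ _)
      (Continuous.intervalIntegrable (by fun_prop) _ _),
      integral_symm_of_odd (g := fun x => D.T x * v x)
        (fun x => by simp only [hv, D.T_even, neg_neg]; ring)] at havg
    linarith
  have hsplit : ∫ x in (-(π / 2))..(π / 2), D.density p p' x =
      (∫ x in (-(π / 2))..(π / 2), D.density u u' x) +
        ∫ x in (-(π / 2))..(π / 2), D.density v v' x := by
    have h1 : ∀ x, D.density p p' x = (D.density u u' x + D.density v v' x) +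
        2 * (D.A x * (u' x * v' x) + D.V x * (u x * v x)) := fun x => by
      simp only [density, hu, hv, hu', hv']; ring
    simp_rw [h1]
    have hcu := D.continuous_density huc huc'
    have hcv := D.continuous_density hvc hvc'
    rw [intervalIntegral.integral_add (Continuous.intervalIntegrable (by fun_prop) _ _)
      (Continuous.intervalIntegrable (by fun_prop) _ _),
      integral_symm_of_odd (g := fun x => 2 * (D.A x * (u' x * v' x) + D.V x * (u x * v x)))
        (fun x => by simp only [hv, hu, hu', hv', D.A_even, D.V_even, neg_neg]; ring),
      intervalIntegral.integral_add ((D.continuous_density huc huc').intervalIntegrable _ _)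
        ((D.continuous_density hvc hvc').intervalIntegrable _ _), add_zero]
  obtain ⟨h1, h2⟩ := D.zero_average_of_ends_eq hud huc' (by simp only [hu, neg_neg]; ring) huavg
  have h3 := D.vanishing_at_zero hvd hvc' (by simp [hv])
  have h4 : 0 ≤ ∫ x in (-(π / 2))..(π / 2), D.e x * v x ^ 2 :=
    intervalIntegral.integral_nonneg (by linarith)
      fun x _ => mul_nonneg (D.e_pos x).le (sq_nonneg _)
  refine ⟨by linarith, fun h0 x hx => ?_⟩
  have h5 := h2 (by linarith) x hx
  have h6 := eq_zero_of_intervalIntegral_eq_zero (by linarith) (by fun_prop)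
    (fun x _ => mul_nonneg (D.e_pos x).le (sq_nonneg (v x))) (by linarith) x hx
  have h7 := pow_eq_zero_iff two_ne_zero |>.1 ((mul_eq_zero.1 h6).resolve_left (D.e_pos x).ne')
  have : p x = u x + v x := by simp only [hu, hv]; ring
  rw [this, h5, h7, add_zero]

/-- Nonnegativity of the form on pairs of functions on the two halves of the circle, with zero
total average and matching values at the ends; the null pairs are the multiples of
`(cos, -cos)`. -/
theorem pair_nonneg {m₁ m₁' m₂ m₂' : ℝ → ℝ} (h₁ : ∀ x, HasDerivAt m₁ (m₁' x) x)
    (h₂ : ∀ x, HasDerivAt m₂ (m₂' x) x) (hc₁ : Continuous m₁') (hc₂ : Continuous m₂')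
    (hl : m₁ (-(π / 2)) = m₂ (-(π / 2))) (hr : m₁ (π / 2) = m₂ (π / 2))
    (havg : (∫ x in (-(π / 2))..(π / 2), D.T x * m₁ x) +
      ∫ x in (-(π / 2))..(π / 2), D.T x * m₂ x = 0) :
    0 ≤ (∫ x in (-(π / 2))..(π / 2), D.density m₁ m₁' x) +
        ∫ x in (-(π / 2))..(π / 2), D.density m₂ m₂' x ∧
      ((∫ x in (-(π / 2))..(π / 2), D.density m₁ m₁' x) +
        ∫ x in (-(π / 2))..(π / 2), D.density m₂ m₂' x = 0 →
        ∃ a : ℝ, ∀ x ∈ Icc (-(π / 2)) (π / 2), m₁ x = a * cos x ∧ m₂ x = -(a * cos x)) := by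
  have hpi := Real.pi_pos
  have hm₁ : Continuous m₁ := continuous_iff_continuousAt.2 fun x => (h₁ x).continuousAt
  have hm₂ : Continuous m₂ := continuous_iff_continuousAt.2 fun x => (h₂ x).continuousAt
  have hT := D.continuous_T
  -- Decomposition under the reflection y ↦ -y: only p sees the average constraint, and the matching
  -- at the ends says that r vanishes there.
  set p : ℝ → ℝ := fun x => m₁ x + m₂ x with hp
  set p' : ℝ → ℝ := fun x => m₁' x + m₂' x with hp'
  set r : ℝ → ℝ := fun x => m₁ x - m₂ x with hrdef
  set r' : ℝ → ℝ := fun x => m₁' x - m₂' x with hr'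
  have hpd : ∀ x, HasDerivAt p (p' x) x := fun x => (h₁ x).add (h₂ x)
  have hrd : ∀ x, HasDerivAt r (r' x) x := fun x => (h₁ x).sub (h₂ x)
  have hsplit : 2 * ((∫ x in (-(π / 2))..(π / 2), D.density m₁ m₁' x) +
      ∫ x in (-(π / 2))..(π / 2), D.density m₂ m₂' x) =
      (∫ x in (-(π / 2))..(π / 2), D.density p p' x) +
        ∫ x in (-(π / 2))..(π / 2), D.density r r' x := by
    rw [← intervalIntegral.integral_add ((D.continuous_density hm₁ hc₁).intervalIntegrable _ _)
      ((D.continuous_density hm₂ hc₂).intervalIntegrable _ _),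
      ← intervalIntegral.integral_const_mul, ← intervalIntegral.integral_add
      ((D.continuous_density (by fun_prop) (by fun_prop)).intervalIntegrable _ _)
      ((D.continuous_density (by fun_prop) (by fun_prop)).intervalIntegrable _ _)]
    refine intervalIntegral.integral_congr fun x _ => ?_
    simp only [density, hp, hp', hrdef, hr']
    ring
  obtain ⟨hp1, hp2⟩ := D.zero_average hpd (by fun_prop) (by
    rw [← havg, ← intervalIntegral.integral_add (Continuous.intervalIntegrable (by fun_prop) _ _)
      (Continuous.intervalIntegrable (by fun_prop) _ _)]
    simp only [hp, mul_add])
  obtain ⟨hr1, hr2⟩ := D.dirichlet hrd (by fun_prop) (by simp [hrdef, hl]) (by simp [hrdef, hr])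
  refine ⟨by linarith, fun h0 => ⟨r 0 / 2, fun x hx => ?_⟩⟩
  have hx1 := hp2 (by linarith) x hx
  have hx2 := hr2 (by linarith) x hx
  simp only [hp] at hx1
  have hx3 : m₁ x - m₂ x = r 0 * cos x := hx2
  constructor <;> linarith

end ZeroModeData

/-! ### Mean and variance over the circles in θ -/

/-- Differentiation under the integral sign for a continuously differentiable integrand. -/
theorem hasDerivAt_parametric_integral {G Gs : ℝ → ℝ → ℝ} (hG : Continuous (Function.uncurry G))
    (hGs : Continuous (Function.uncurry Gs))
    (hd : ∀ x t, HasDerivAt (fun s => G s t) (Gs x t) x) (a b x : ℝ) :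
    HasDerivAt (fun s => ∫ t in a..b, G s t) (∫ t in a..b, Gs x t) x := by
  have hG' : ∀ s, Continuous (G s) := fun s => hG.comp (Continuous.prodMk_right s)
  have hGs' : ∀ s, Continuous (Gs s) := fun s => hGs.comp (Continuous.prodMk_right s)
  obtain ⟨C, hC⟩ := ((isCompact_closedBall x 1).prod (isCompact_uIcc (a := a) (b := b))
    ).exists_bound_of_continuousOn hGs.continuousOn
  refine (intervalIntegral.hasDerivAt_integral_of_dominated_loc_of_deriv_le
    (s := Metric.closedBall x 1) (bound := fun _ => C) (Metric.closedBall_mem_nhds x one_pos)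
    (Eventually.of_forall fun s => (hG' s).aestronglyMeasurable)
    ((hG' x).intervalIntegrable _ _) (hGs' x).aestronglyMeasurable ?_ (by simp) ?_).2
  · exact Eventually.of_forall fun t ht s hs => hC (s, t) ⟨hs, uIoc_subset_uIcc ht⟩
  · exact Eventually.of_forall fun t _ s _ => hd s t

/-- The square of an integral is bounded by the length times the integral of the square. -/
theorem sq_integral_le {g : ℝ → ℝ} (hg : Continuous g) {x : ℝ} (hx : 0 ≤ x) :
    (∫ t in (0 : ℝ)..x, g t) ^ 2 ≤ x * ∫ t in (0 : ℝ)..x, g t ^ 2 := by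
  rcases hx.eq_or_lt with rfl | hx
  · simp
  set I := ∫ t in (0 : ℝ)..x, g t with hI
  have h1 : 0 ≤ ∫ t in (0 : ℝ)..x, (g t - I / x) ^ 2 :=
    intervalIntegral.integral_nonneg hx.le fun t _ => sq_nonneg _
  have h2 : ∫ t in (0 : ℝ)..x, (g t - I / x) ^ 2 =
      (∫ t in (0 : ℝ)..x, g t ^ 2) - 2 * (I / x) * I + x * (I / x) ^ 2 := by
    have : ∀ t, (g t - I / x) ^ 2 = (g t ^ 2 - 2 * (I / x) * g t) + (I / x) ^ 2 :=
      fun t => by ring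
    simp_rw [this]
    rw [intervalIntegral.integral_add (Continuous.intervalIntegrable (by fun_prop) _ _)
      (Continuous.intervalIntegrable (by fun_prop) _ _),
      intervalIntegral.integral_sub (Continuous.intervalIntegrable (by fun_prop) _ _)
      (Continuous.intervalIntegrable (by fun_prop) _ _), intervalIntegral.integral_const_mul,
      intervalIntegral.integral_const, ← hI]
    simp
  rw [h2] at h1
  have h3 : x * (2 * (I / x) * I - x * (I / x) ^ 2) = I ^ 2 := by
    field_simp; ring
  rw [← h3]
  exact mul_le_mul_of_nonneg_left (by linarith) hx.le

/-- The mean over `[0, 2π]`. -/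
def angularMean (g : ℝ → ℝ) : ℝ := (2 * π)⁻¹ * ∫ t in (0 : ℝ)..(2 * π), g t

theorem integral_eq_angularMean (g : ℝ → ℝ) :
    ∫ t in (0 : ℝ)..(2 * π), g t = 2 * π * angularMean g := by
  have := Real.pi_pos
  unfold angularMean
  field_simp

/-- The parallel axis identity. It is used with a the mean, for nonnegativity of the variance, and
with a = g 0, for the Poincaré inequality. -/
theorem integral_sub_const_sq {g : ℝ → ℝ} (hg : Continuous g) (a : ℝ) :
    ∫ t in (0 : ℝ)..(2 * π), (g t - a) ^ 2 =
      (∫ t in (0 : ℝ)..(2 * π), g t ^ 2) - 2 * π * angularMean g ^ 2 +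
        2 * π * (angularMean g - a) ^ 2 := by
  have : ∀ t, (g t - a) ^ 2 = (g t ^ 2 - 2 * a * g t) + a ^ 2 := fun t => by ring
  simp_rw [this]
  rw [intervalIntegral.integral_add (Continuous.intervalIntegrable (by fun_prop) _ _)
    (Continuous.intervalIntegrable (by fun_prop) _ _),
    intervalIntegral.integral_sub (Continuous.intervalIntegrable (by fun_prop) _ _)
    (Continuous.intervalIntegrable (by fun_prop) _ _), intervalIntegral.integral_const_mul,
    intervalIntegral.integral_const, integral_eq_angularMean g]
  simp only [sub_zero, smul_eq_mul]
  ring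

/-- The variance over `[0, 2π]`. -/
def angularVar (g : ℝ → ℝ) : ℝ :=
  (∫ t in (0 : ℝ)..(2 * π), g t ^ 2) - 2 * π * angularMean g ^ 2

theorem angularVar_eq {g : ℝ → ℝ} (hg : Continuous g) :
    angularVar g = ∫ t in (0 : ℝ)..(2 * π), (g t - angularMean g) ^ 2 := by
  rw [integral_sub_const_sq hg]
  simp [angularVar]

theorem angularVar_nonneg {g : ℝ → ℝ} (hg : Continuous g) : 0 ≤ angularVar g := by
  rw [angularVar_eq hg]
  exact intervalIntegral.integral_nonneg (by positivity) fun t _ => sq_nonneg _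

theorem eq_angularMean_of_angularVar_eq_zero {g : ℝ → ℝ} (hg : Continuous g)
    (h : angularVar g = 0) : ∀ t ∈ Icc 0 (2 * π), g t = angularMean g := fun t ht => by
  rw [angularVar_eq hg] at h
  have := eq_zero_of_intervalIntegral_eq_zero (by positivity) (by fun_prop)
    (fun t _ => sq_nonneg (g t - angularMean g)) h.le t ht
  exact sub_eq_zero.1 (pow_eq_zero_iff two_ne_zero |>.1 this)

/-- A Poincaré inequality on `[0, 2π]`. -/
theorem angularVar_le {g g' : ℝ → ℝ} (hg : ∀ t, HasDerivAt g (g' t) t) (hg' : Continuous g') :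
    angularVar g ≤ 4 * π ^ 2 * ∫ t in (0 : ℝ)..(2 * π), g' t ^ 2 := by
  have hpi := Real.pi_pos
  have hgc : Continuous g := continuous_iff_continuousAt.2 fun x => (hg x).continuousAt
  have h1 := integral_sub_const_sq hgc (g 0)
  have h2 : angularVar g ≤ ∫ t in (0 : ℝ)..(2 * π), (g t - g 0) ^ 2 := by
    rw [h1, angularVar]
    have : 0 ≤ 2 * π * (angularMean g - g 0) ^ 2 := by positivity
    linarith
  set J := ∫ t in (0 : ℝ)..(2 * π), g' t ^ 2 with hJ
  -- Cauchy–Schwarz from the base point 0. This needs no boundary condition and costs a nonsharp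
  -- constant, which only enlarges β.
  have h3 : ∀ t ∈ Icc 0 (2 * π), (g t - g 0) ^ 2 ≤ 2 * π * J := fun t ht => by
    have e1 : ∫ s in (0 : ℝ)..t, g' s = g t - g 0 :=
      intervalIntegral.integral_eq_sub_of_hasDerivAt (fun x _ => hg x)
        (hg'.intervalIntegrable _ _)
    rw [← e1]
    refine (sq_integral_le hg' ht.1).trans ?_
    have e2 : ∫ s in (0 : ℝ)..t, g' s ^ 2 ≤ J :=
      intervalIntegral.integral_mono_interval le_rfl ht.1 ht.2
        (Eventually.of_forall fun _ => sq_nonneg _) ((hg'.pow 2).intervalIntegrable _ _)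
    exact mul_le_mul ht.2 e2 (intervalIntegral.integral_nonneg ht.1 fun _ _ => sq_nonneg _)
      (by positivity)
  have h4 : ∫ t in (0 : ℝ)..(2 * π), (g t - g 0) ^ 2 ≤ ∫ t in (0 : ℝ)..(2 * π), 2 * π * J :=
    intervalIntegral.integral_mono_on (by positivity)
      (Continuous.intervalIntegrable (by fun_prop) _ _) (by simp) h3
  rw [intervalIntegral.integral_const] at h4
  simp only [sub_zero, smul_eq_mul] at h4
  linarith

/-- A function on the cylinder with continuous first partial derivatives. -/
structure CylinderFun where
  G : ℝ → ℝ → ℝ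
  Gs : ℝ → ℝ → ℝ
  Gt : ℝ → ℝ → ℝ
  continuous_G : Continuous (Function.uncurry G)
  continuous_Gs : Continuous (Function.uncurry Gs)
  continuous_Gt : Continuous (Function.uncurry Gt)
  hasDerivAt_s : ∀ x t, HasDerivAt (fun s => G s t) (Gs x t) x
  hasDerivAt_t : ∀ x t, HasDerivAt (G x) (Gt x t) t

/-! ### From invariant functions to all functions on the torus -/

namespace ZeroModeData

variable (D : ZeroModeData)

/-- The integral of the index density over the circle `σ = x`. -/
def circleIndex (K : ℝ → ℝ) (g : CylinderFun) (x : ℝ) : ℝ :=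
  ∫ t in (0 : ℝ)..(2 * π), (D.A x * g.Gs x t ^ 2 + K x * g.Gt x t ^ 2 + D.V x * g.G x t ^ 2)

theorem continuous_circleIndex {K : ℝ → ℝ} (hK : Continuous K) (g : CylinderFun) :
    Continuous (D.circleIndex K g) := by
  have := D.continuous_A
  have := D.continuous_V
  have := g.continuous_G
  have := g.continuous_Gs
  have := g.continuous_Gt
  unfold circleIndex
  fun_prop

/-- Each square integral is 2π times the squared mean plus the variance. The variance of the
σ-derivative is discarded, and the θ-derivative controls the variance of the function itself. -/
theorem le_circleIndex {K : ℝ → ℝ} (hK : ∀ x, 0 ≤ K x) (g : CylinderFun) (x : ℝ) :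
    2 * π * D.density (fun s => angularMean (g.G s)) (fun s => angularMean (g.Gs s)) x +
      (K x / (4 * π ^ 2) + D.V x) * angularVar (g.G x) ≤ D.circleIndex K g x := by
  have hpi := Real.pi_pos
  have hG : Continuous (g.G x) := g.continuous_G.comp (Continuous.prodMk_right x)
  have hGs : Continuous (g.Gs x) := g.continuous_Gs.comp (Continuous.prodMk_right x)
  have hGt : Continuous (g.Gt x) := g.continuous_Gt.comp (Continuous.prodMk_right x)
  have h1 : D.circleIndex K g x = D.A x * (∫ t in (0 : ℝ)..(2 * π), g.Gs x t ^ 2) +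
      K x * (∫ t in (0 : ℝ)..(2 * π), g.Gt x t ^ 2) +
      D.V x * ∫ t in (0 : ℝ)..(2 * π), g.G x t ^ 2 := by
    unfold circleIndex
    rw [intervalIntegral.integral_add (Continuous.intervalIntegrable (by fun_prop) _ _)
      (Continuous.intervalIntegrable (by fun_prop) _ _),
      intervalIntegral.integral_add (Continuous.intervalIntegrable (by fun_prop) _ _)
      (Continuous.intervalIntegrable (by fun_prop) _ _), intervalIntegral.integral_const_mul,
      intervalIntegral.integral_const_mul, intervalIntegral.integral_const_mul]
  have h2 := angularVar_nonneg hGs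
  have h3 := angularVar_le (g.hasDerivAt_t x) hGt
  have h4 : K x * (angularVar (g.G x) / (4 * π ^ 2)) ≤
      K x * ∫ t in (0 : ℝ)..(2 * π), g.Gt x t ^ 2 :=
    mul_le_mul_of_nonneg_left ((div_le_iff₀' (by positivity)).2 h3) (hK x)
  have h5 := mul_nonneg (D.A_pos x).le h2
  have h6 : ∫ t in (0 : ℝ)..(2 * π), g.G x t ^ 2 =
    angularVar (g.G x) + 2 * π * angularMean (g.G x) ^ 2 := by simp [angularVar]
  rw [h1, h6]
  rw [angularVar] at h5
  simp only [density]
  have h7 : K x / (4 * π ^ 2) * angularVar (g.G x) = K x * (angularVar (g.G x) / (4 * π ^ 2)) := by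
    ring
  linarith

theorem hasDerivAt_angularMean (g : CylinderFun) (x : ℝ) :
    HasDerivAt (fun s => angularMean (g.G s)) (angularMean (g.Gs x)) x :=
  (hasDerivAt_parametric_integral g.continuous_G g.continuous_Gs g.hasDerivAt_s 0 (2 * π)
    x).const_mul _

theorem continuous_angularMean {G : ℝ → ℝ → ℝ} (hG : Continuous (Function.uncurry G)) :
    Continuous fun s => angularMean (G s) := by
  unfold angularMean
  fun_prop

theorem continuous_angularVar {G : ℝ → ℝ → ℝ} (hG : Continuous (Function.uncurry G)) :
    Continuous fun s => angularVar (G s) := by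
  have := continuous_angularMean hG
  unfold angularVar
  fun_prop

/-- Positivity of the index form on pairs of functions on the two halves of the torus. -/
theorem index_pos {K : ℝ → ℝ} (hKc : Continuous K) (hK : ∀ x, 0 ≤ K x)
    (hKV : ∀ x, 0 < K x / (4 * π ^ 2) + D.V x) (g₁ g₂ : CylinderFun)
    (hl : ∀ t, g₁.G (-(π / 2)) t = g₂.G (-(π / 2)) t) (hr : ∀ t, g₁.G (π / 2) t = g₂.G (π / 2) t)
    (havg : (∫ x in (-(π / 2))..(π / 2), ∫ t in (0 : ℝ)..(2 * π), D.T x * g₁.G x t) +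
      (∫ x in (-(π / 2))..(π / 2), ∫ t in (0 : ℝ)..(2 * π), D.T x * g₂.G x t) = 0)
    (hne : ¬ ∃ a : ℝ, ∀ x ∈ Icc (-(π / 2)) (π / 2), ∀ t ∈ Icc 0 (2 * π),
      g₁.G x t = a * cos x ∧ g₂.G x t = -(a * cos x)) :
    0 < (∫ x in (-(π / 2))..(π / 2), D.circleIndex K g₁ x) +
      ∫ x in (-(π / 2))..(π / 2), D.circleIndex K g₂ x := by
  have hpi := Real.pi_pos
  have hlt : -(π / 2) < π / 2 := by linarith
  have hVc := D.continuous_V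
  have havg' : (∫ x in (-(π / 2))..(π / 2), D.T x * angularMean (g₁.G x)) +
      ∫ x in (-(π / 2))..(π / 2), D.T x * angularMean (g₂.G x) = 0 := by
    have h : ∀ g : CylinderFun, ∀ x, ∫ t in (0 : ℝ)..(2 * π), D.T x * g.G x t =
        2 * π * (D.T x * angularMean (g.G x)) := fun g x => by
      rw [intervalIntegral.integral_const_mul, integral_eq_angularMean]; ring
    simp only [h, intervalIntegral.integral_const_mul] at havg
    rw [← mul_add] at havg
    exact (mul_eq_zero.1 havg).resolve_left (by positivity)
  obtain ⟨hnn, heq⟩ := D.pair_nonneg (hasDerivAt_angularMean g₁) (hasDerivAt_angularMean g₂)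
    (continuous_angularMean g₁.continuous_Gs) (continuous_angularMean g₂.continuous_Gs)
    (by rw [show g₁.G (-(π / 2)) = g₂.G (-(π / 2)) from funext hl])
    (by rw [show g₁.G (π / 2) = g₂.G (π / 2) from funext hr]) havg'
  set q : CylinderFun → ℝ := fun g => ∫ x in (-(π / 2))..(π / 2),
    D.density (fun s => angularMean (g.G s)) (fun s => angularMean (g.Gs s)) x with hq
  set v : CylinderFun → ℝ := fun g => ∫ x in (-(π / 2))..(π / 2),
    (K x / (4 * π ^ 2) + D.V x) * angularVar (g.G x) with hv
  have hvc : ∀ g : CylinderFun,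
      Continuous fun x => (K x / (4 * π ^ 2) + D.V x) * angularVar (g.G x) := fun g => by
    have := continuous_angularVar g.continuous_G
    fun_prop
  have hvpos : ∀ g : CylinderFun, ∀ x, 0 ≤ (K x / (4 * π ^ 2) + D.V x) * angularVar (g.G x) :=
    fun g x => mul_nonneg (hKV x).le
      (angularVar_nonneg (g.continuous_G.comp (Continuous.prodMk_right x)))
  have hvnn : ∀ g, 0 ≤ v g := fun g =>
    intervalIntegral.integral_nonneg hlt.le fun x _ => hvpos g x
  have hle : ∀ g : CylinderFun,
      2 * π * q g + v g ≤ ∫ x in (-(π / 2))..(π / 2), D.circleIndex K g x := fun g => by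
    have hd := D.continuous_density (continuous_angularMean g.continuous_G)
      (continuous_angularMean g.continuous_Gs)
    simp only [hq, hv]
    rw [← intervalIntegral.integral_const_mul, ← intervalIntegral.integral_add
      (Continuous.intervalIntegrable (by fun_prop) _ _) ((hvc g).intervalIntegrable _ _)]
    exact intervalIntegral.integral_mono_on hlt.le
      (Continuous.intervalIntegrable ((continuous_const.mul hd).add (hvc g)) _ _)
      ((D.continuous_circleIndex hKc g).intervalIntegrable _ _)
      fun x _ => D.le_circleIndex hK g x
  -- If the form were not positive, all the nonnegative pieces would vanish: the variances force
  -- independence of θ, and the means form a multiple of (cos, -cos), which is excluded.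
  by_contra! hneg
  have h1 := hle g₁
  have h2 := hle g₂
  have h3 := hvnn g₁
  have h4 := hvnn g₂
  have h5 : 0 ≤ 2 * π * (q g₁ + q g₂) := mul_nonneg (by positivity) hnn
  have h6 : q g₁ + q g₂ = 0 :=
    (mul_eq_zero.1 (by linarith : 2 * π * (q g₁ + q g₂) = 0)).resolve_left (by positivity)
  obtain ⟨a, ha⟩ := heq h6
  have hcon : ∀ g, v g = 0 → ∀ x ∈ Icc (-(π / 2)) (π / 2), ∀ t ∈ Icc 0 (2 * π),
      g.G x t = angularMean (g.G x) := fun g hg x hx =>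
    eq_angularMean_of_angularVar_eq_zero (g.continuous_G.comp (Continuous.prodMk_right x))
      ((mul_eq_zero.1 (eq_zero_of_intervalIntegral_eq_zero hlt (hvc g) (fun x _ => hvpos g x)
        hg.le x hx)).resolve_left (hKV x).ne')
  refine hne ⟨a, fun x hx t ht => ?_⟩
  rw [hcon g₁ (by linarith) x hx t ht, hcon g₂ (by linarith) x hx t ht]
  exact ha x hx

end ZeroModeData

/-! ### The Levi-Civita connection and the Ricci tensor of the tube -/

theorem tubeMetric_inv {f : ℝ → ℝ} {c : ℝ} (hc : c ≠ 0) {x : Fin 3 → ℝ} (hf : f (x 0) ≠ 0) :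
    (tubeMetric f c x)⁻¹ = Matrix.diagonal ![1, (c ^ 2 * f (x 0) ^ 2)⁻¹, 1] := by
  refine Matrix.inv_eq_right_inv ?_
  have : c ^ 2 * f (x 0) ^ 2 ≠ 0 := by positivity
  rw [tubeMetric, Matrix.diagonal_mul_diagonal, ← Matrix.diagonal_one]
  congr 1
  ext i
  fin_cases i <;> simp [field]

theorem metricInner_tubeMetric (f : ℝ → ℝ) (c : ℝ) (x v w : Fin 3 → ℝ) :
    metricInner (tubeMetric f c) x v w =
      v 0 * w 0 + c ^ 2 * f (x 0) ^ 2 * (v 1 * w 1) + v 2 * w 2 := by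
  simp [metricInner, tubeMetric, dotProduct, Fin.sum_univ_three, Matrix.mulVec_diagonal]
  ring

/-- The Christoffel symbols of the tube as functions of `s`. -/
def tubeChristoffel (f : ℝ → ℝ) (c : ℝ) (k i j : Fin 3) (s : ℝ) : ℝ :=
  if k = 0 ∧ i = 1 ∧ j = 1 then -(c ^ 2 * f s * deriv f s)
  else if k = 1 ∧ ((i = 0 ∧ j = 1) ∨ (i = 1 ∧ j = 0)) then deriv f s / f s else 0

theorem partialDeriv_tubeMetric {f : ℝ → ℝ} {c : ℝ} {x : Fin 3 → ℝ}
    (hf : DifferentiableAt ℝ f (x 0)) (i j l : Fin 3) :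
    partialDeriv i (fun z => tubeMetric f c z j l) x =
      if i = 0 ∧ j = 1 ∧ l = 1 then 2 * c ^ 2 * f (x 0) * deriv f (x 0) else 0 := by
  have h : deriv (fun t => c ^ 2 * f t ^ 2) (x 0) = 2 * c ^ 2 * f (x 0) * deriv f (x 0) := by
    have := ((hf.hasDerivAt.pow 2).const_mul (c ^ 2)).deriv
    simp only [Pi.pow_apply] at this
    rw [this]
    ring
  unfold partialDeriv tubeMetric
  fin_cases i <;> fin_cases j <;> fin_cases l <;>
    simp [Matrix.diagonal, -mul_eq_zero, -deriv_const_mul_field', h]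

theorem christoffel_tubeMetric {f : ℝ → ℝ} {c : ℝ} (hc : c ≠ 0) {x : Fin 3 → ℝ}
    (hf0 : f (x 0) ≠ 0) (hf : DifferentiableAt ℝ f (x 0)) (k i j : Fin 3) :
    christoffel (tubeMetric f c) k i j x = tubeChristoffel f c k i j (x 0) := by
  unfold christoffel tubeChristoffel
  simp only [partialDeriv_tubeMetric hf, tubeMetric_inv hc hf0, Fin.sum_univ_three]
  fin_cases k <;> fin_cases i <;> fin_cases j <;> simp [Matrix.diagonal] <;> field_simp

theorem partialDeriv_christoffel {f : ℝ → ℝ} {c : ℝ} (hc : c ≠ 0) {x : Fin 3 → ℝ}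
    (hf0 : f (x 0) ≠ 0) (hf : ∀ᶠ s in 𝓝 (x 0), DifferentiableAt ℝ f s) (m k i j : Fin 3) :
    partialDeriv m (christoffel (tubeMetric f c) k i j) x =
      if m = 0 then deriv (tubeChristoffel f c k i j) (x 0) else 0 := by
  unfold partialDeriv
  split_ifs with hm
  · subst hm
    refine EventuallyEq.deriv_eq ?_
    -- The closed formula for the symbols requires f nonzero and differentiable, so it is
    -- differentiated only as an identity of germs.
    filter_upwards [hf, hf.self_of_nhds.continuousAt.eventually_ne hf0] with t h1 h2
    rw [christoffel_tubeMetric hc (by simpa using h2) (by simpa using h1)]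
    simp
  · have : ∀ t, christoffel (tubeMetric f c) k i j (Function.update x m t) =
        tubeChristoffel f c k i j (x 0) := fun t => by
      have hx : Function.update x m t 0 = x 0 := Function.update_of_ne (Ne.symm hm) _ _
      rw [christoffel_tubeMetric hc (by rwa [hx]) (by rw [hx]; exact hf.self_of_nhds), hx]
    simp [this]

theorem deriv_tubeChristoffel_zero {f : ℝ → ℝ} {c : ℝ} {k i j : Fin 3}
    (h : ¬(k = 0 ∧ i = 1 ∧ j = 1)) (h' : ¬(k = 1 ∧ ((i = 0 ∧ j = 1) ∨ (i = 1 ∧ j = 0)))) (s : ℝ) :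
    deriv (tubeChristoffel f c k i j) s = 0 := by
  have : tubeChristoffel f c k i j = fun _ => 0 := by
    funext t
    rw [tubeChristoffel, if_neg h, if_neg h']
  simp [this]

theorem deriv_tubeChristoffel_radial {f : ℝ → ℝ} {c : ℝ} (s : ℝ) :
    deriv (tubeChristoffel f c 1 0 1) s = deriv (fun t => deriv f t / f t) s := by
  congr 1

/-- `Ric(v, v)` for vectors orthogonal to `∂_θ`. -/
theorem ricciQuad_tubeMetric {f : ℝ → ℝ} {c : ℝ} (hc : c ≠ 0) {x v : Fin 3 → ℝ}
    (hf0 : f (x 0) ≠ 0) (hf : ∀ᶠ s in 𝓝 (x 0), DifferentiableAt ℝ f s) (hv : v 1 = 0) :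
    ricciQuad (tubeMetric f c) x v =
      -(deriv (fun t => deriv f t / f t) (x 0) + (deriv f (x 0) / f (x 0)) ^ 2) * v 0 ^ 2 := by
  have h00 : ricciTensor (tubeMetric f c) 0 0 x =
      -(deriv (fun t => deriv f t / f t) (x 0) + (deriv f (x 0) / f (x 0)) ^ 2) := by
    unfold ricciTensor
    simp only [partialDeriv_christoffel hc hf0 hf, christoffel_tubeMetric hc hf0 hf.self_of_nhds,
      Fin.sum_univ_three, deriv_tubeChristoffel_radial]
    simp [deriv_tubeChristoffel_zero]
    simp [tubeChristoffel]
    ring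
  have h02 : ricciTensor (tubeMetric f c) 0 2 x = 0 := by
    unfold ricciTensor
    simp only [partialDeriv_christoffel hc hf0 hf, christoffel_tubeMetric hc hf0 hf.self_of_nhds,
      Fin.sum_univ_three]
    simp [deriv_tubeChristoffel_zero]
    simp [tubeChristoffel]
  have h20 : ricciTensor (tubeMetric f c) 2 0 x = 0 := by
    unfold ricciTensor
    simp only [partialDeriv_christoffel hc hf0 hf, christoffel_tubeMetric hc hf0 hf.self_of_nhds,
      Fin.sum_univ_three]
    simp [deriv_tubeChristoffel_zero]
    simp [tubeChristoffel]
  have h22 : ricciTensor (tubeMetric f c) 2 2 x = 0 := by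
    unfold ricciTensor
    simp only [partialDeriv_christoffel hc hf0 hf, christoffel_tubeMetric hc hf0 hf.self_of_nhds,
      Fin.sum_univ_three]
    simp [deriv_tubeChristoffel_zero]
    simp [tubeChristoffel]
  simp only [ricciQuad, Fin.sum_univ_three, hv, h00, h02, h20, h22]
  ring

/-! ### The geometry of the bubbles -/

section Bubble

variable {f : ℝ → ℝ} {c s₁ : ℝ} {ε : ℤˣ} {q : Fin 2 → ℝ} {p : ℝ → ℝ} {p' : ℝ}

theorem units_cast_sq (ε : ℤˣ) : ((ε : ℤ) : ℝ) ^ 2 = 1 := by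
  rcases Int.units_eq_one_or ε with rfl | rfl <;> simp

theorem bubble_tangent_zero (hU : HasDerivAt (profile f s₁) (p (q 0)) (q 0)) :
    (bubble f s₁ ε).tangent 0 q = ![1, 0, ((ε : ℤ) : ℝ) * p (q 0)] := by
  unfold SurfacePatch.tangent partialDeriv bubble
  refine HasDerivAt.deriv (hasDerivAt_pi.2 fun i => ?_)
  fin_cases i
  · simpa using hasDerivAt_id' (q 0)
  · simpa using hasDerivAt_const (q 0) (q 1)
  · simpa using hU.const_mul ((ε : ℤ) : ℝ)

theorem bubble_tangent_one : (bubble f s₁ ε).tangent 1 q = ![0, 1, 0] := by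
  unfold SurfacePatch.tangent partialDeriv bubble
  refine HasDerivAt.deriv (hasDerivAt_pi.2 fun i => ?_)
  fin_cases i
  · simpa using hasDerivAt_const (q 1) (q 0)
  · simpa using hasDerivAt_id' (q 1)
  · simpa using hasDerivAt_const (q 1) (((ε : ℤ) : ℝ) * profile f s₁ (q 0))

theorem bubble_map_zero : (bubble f s₁ ε).map q 0 = q 0 := rfl

theorem bubble_firstForm (hU : HasDerivAt (profile f s₁) (p (q 0)) (q 0)) :
    (bubble f s₁ ε).firstForm (tubeMetric f c) q =
      Matrix.diagonal ![1 + p (q 0) ^ 2, c ^ 2 * f (q 0) ^ 2] := by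
  ext a b
  have := units_cast_sq ε
  fin_cases a <;> fin_cases b <;>
    simp [SurfacePatch.firstForm, metricInner_tubeMetric, bubble_tangent_zero hU,
      bubble_tangent_one, bubble_map_zero]
  linear_combination (p (q 0)) ^ 2 * this

theorem bubble_firstForm_inv (hc : c ≠ 0) (hf0 : f (q 0) ≠ 0)
    (hU : HasDerivAt (profile f s₁) (p (q 0)) (q 0)) :
    ((bubble f s₁ ε).firstForm (tubeMetric f c) q)⁻¹ =
      Matrix.diagonal ![(1 + p (q 0) ^ 2)⁻¹, (c ^ 2 * f (q 0) ^ 2)⁻¹] := by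
  rw [bubble_firstForm hU]
  refine Matrix.inv_eq_right_inv ?_
  have : 1 + p (q 0) ^ 2 ≠ 0 := by positivity
  rw [Matrix.diagonal_mul_diagonal, ← Matrix.diagonal_one]
  congr 1
  ext i
  fin_cases i <;> simp [this, field]

theorem bubble_areaDensity (hc : 0 < c) (hf0 : 0 < f (q 0))
    (hU : HasDerivAt (profile f s₁) (p (q 0)) (q 0)) :
    (bubble f s₁ ε).areaDensity (tubeMetric f c) q = c * f (q 0) * √(1 + p (q 0) ^ 2) := by
  rw [SurfacePatch.areaDensity, bubble_firstForm hU, Matrix.det_diagonal]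
  simp only [Fin.prod_univ_two, Matrix.cons_val_zero, Matrix.cons_val_one]
  rw [← mul_pow, Real.sqrt_mul (by positivity), Real.sqrt_sq (by positivity), mul_comm]

/-- The conormal always has y-component 1, so multiplying by the side ε makes the normal point
outward on both halves; in the s-component the two factors ε cancel. -/
theorem bubble_unitNormal (hc : c ≠ 0) (hf0 : f (q 0) ≠ 0)
    (hU : HasDerivAt (profile f s₁) (p (q 0)) (q 0)) :
    (bubble f s₁ ε).unitNormal (tubeMetric f c) q =
      ![-p (q 0) / √(1 + p (q 0) ^ 2), 0, ((ε : ℤ) : ℝ) / √(1 + p (q 0) ^ 2)] := by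
  have hε := units_cast_sq ε
  have hcon : (bubble f s₁ ε).conormal q = ![-(((ε : ℤ) : ℝ) * p (q 0)), 0, 1] := by
    rw [SurfacePatch.conormal, bubble_tangent_zero hU, bubble_tangent_one, cross_apply]
    simp
  have hN : (tubeMetric f c ((bubble f s₁ ε).map q))⁻¹ *ᵥ (bubble f s₁ ε).conormal q =
      ![-(((ε : ℤ) : ℝ) * p (q 0)), 0, 1] := by
    rw [tubeMetric_inv hc (by rwa [bubble_map_zero]), hcon]
    ext i
    fin_cases i <;> simp [Matrix.mulVec_diagonal]
  have hsq : metricInner (tubeMetric f c) ((bubble f s₁ ε).map q)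
      ![-(((ε : ℤ) : ℝ) * p (q 0)), 0, 1] ![-(((ε : ℤ) : ℝ) * p (q 0)), 0, 1] =
      1 + p (q 0) ^ 2 := by
    simp [metricInner_tubeMetric]
    linear_combination (p (q 0)) ^ 2 * hε
  simp only [SurfacePatch.unitNormal, hN, hsq]
  have hside : (bubble f s₁ ε).side = ε := rfl
  rw [hside]
  ext i
  fin_cases i <;> simp
  · linear_combination (-p (q 0) / √(1 + p (q 0) ^ 2)) * hε

theorem bubble_partialY_inner (hc : c ≠ 0) (hf0 : f (q 0) ≠ 0)
    (hU : HasDerivAt (profile f s₁) (p (q 0)) (q 0)) :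
    metricInner (tubeMetric f c) ((bubble f s₁ ε).map q) partialY
      ((bubble f s₁ ε).unitNormal (tubeMetric f c) q) =
      ((ε : ℤ) : ℝ) / √(1 + p (q 0) ^ 2) := by
  rw [bubble_unitNormal hc hf0 hU, metricInner_tubeMetric]
  simp [partialY]

theorem bubble_gradNormSq (hc : c ≠ 0) (hf0 : f (q 0) ≠ 0)
    (hU : HasDerivAt (profile f s₁) (p (q 0)) (q 0)) (u : (Fin 3 → ℝ) → ℝ) :
    (bubble f s₁ ε).gradNormSq (tubeMetric f c) u q =
      partialDeriv 0 (fun z => u ((bubble f s₁ ε).map z)) q ^ 2 / (1 + p (q 0) ^ 2) +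
        partialDeriv 1 (fun z => u ((bubble f s₁ ε).map z)) q ^ 2 / (c ^ 2 * f (q 0) ^ 2) := by
  simp only [SurfacePatch.gradNormSq, bubble_firstForm_inv hc hf0 hU, Fin.sum_univ_two]
  simp [Matrix.diagonal]
  ring

theorem bubble_secondForm (hc : c ≠ 0) (hf0 : f (q 0) ≠ 0) (hf : DifferentiableAt ℝ f (q 0))
    (hU : ∀ᶠ t in 𝓝 (q 0), HasDerivAt (profile f s₁) (p t) t) (hp : HasDerivAt p p' (q 0)) :
    (bubble f s₁ ε).secondForm (tubeMetric f c) q =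
      Matrix.diagonal ![p' / √(1 + p (q 0) ^ 2),
        c ^ 2 * f (q 0) * deriv f (q 0) * p (q 0) / √(1 + p (q 0) ^ 2)] := by
  have hε := units_cast_sq ε
  have hU0 := hU.self_of_nhds
  have h00 : partialDeriv 0 ((bubble f s₁ ε).tangent 0) q = ![0, 0, ((ε : ℤ) : ℝ) * p'] := by
    unfold partialDeriv
    have : (fun t => (bubble f s₁ ε).tangent 0 (Function.update q 0 t)) =ᶠ[𝓝 (q 0)]
        fun t => ![1, 0, ((ε : ℤ) : ℝ) * p t] := by
      filter_upwards [hU] with t ht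
      rw [bubble_tangent_zero (p := p) (by simpa using ht)]
      simp
    rw [this.deriv_eq]
    refine HasDerivAt.deriv (hasDerivAt_pi.2 fun i => ?_)
    fin_cases i
    · simpa using hasDerivAt_const (q 0) (1 : ℝ)
    · simpa using hasDerivAt_const (q 0) (0 : ℝ)
    · simpa using hp.const_mul ((ε : ℤ) : ℝ)
  have h10 : partialDeriv 1 ((bubble f s₁ ε).tangent 0) q = 0 := by
    unfold partialDeriv
    have : ∀ t, (bubble f s₁ ε).tangent 0 (Function.update q 1 t) =
        ![1, 0, ((ε : ℤ) : ℝ) * p (q 0)] := fun t => by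
      rw [bubble_tangent_zero (p := p) (by simpa using hU0)]
      simp
    simp [this]
  have ha1 : ∀ a, partialDeriv a ((bubble f s₁ ε).tangent 1) q = 0 := fun a => by
    unfold partialDeriv
    simp [bubble_tangent_one]
  ext a b
  simp only [SurfacePatch.secondForm, SurfacePatch.covDerivTangent, metricInner_tubeMetric,
    bubble_unitNormal hc hf0 hU0, Matrix.of_apply, Fin.sum_univ_three]
  simp only [christoffel_tubeMetric (x := (bubble f s₁ ε).map q) hc hf0 hf, bubble_map_zero]
  fin_cases a <;> fin_cases b <;>
    simp [h00, h10, ha1, bubble_tangent_zero hU0, bubble_tangent_one, tubeChristoffel]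
  · linear_combination (p' / √(1 + p (q 0) ^ 2)) * hε
  · ring

/-- The squared principal curvature of the θ-circles is (f'/f)² p²/(1 + p²), and it cancels the
(f'/f)² term of the Ricci curvature. Only (log f)'' and the curvature of the profile remain. -/
theorem bubble_jacobiPotential (hc : c ≠ 0) (hf0 : f (q 0) ≠ 0)
    (hf : ∀ᶠ s in 𝓝 (q 0), DifferentiableAt ℝ f s)
    (hU : ∀ᶠ t in 𝓝 (q 0), HasDerivAt (profile f s₁) (p t) t) (hp : HasDerivAt p p' (q 0)) :
    (bubble f s₁ ε).jacobiPotential (tubeMetric f c) q =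
      deriv (fun t => deriv f t / f t) (q 0) * (p (q 0) ^ 2 / (1 + p (q 0) ^ 2)) -
        p' ^ 2 / (1 + p (q 0) ^ 2) ^ 3 := by
  have hU0 := hU.self_of_nhds
  have hpos : 0 < 1 + p (q 0) ^ 2 := by positivity
  rw [SurfacePatch.jacobiPotential, ricciQuad_tubeMetric hc hf0 hf
    (by rw [bubble_unitNormal hc hf0 hU0]; simp), bubble_unitNormal hc hf0 hU0, bubble_map_zero]
  simp only [SurfacePatch.secondFormNormSq, bubble_firstForm_inv hc hf0 hU0,
    bubble_secondForm hc hf0 hf.self_of_nhds hU hp, Fin.sum_univ_two]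
  have hs : √(1 + p (q 0) ^ 2) ^ 2 = 1 + p (q 0) ^ 2 := Real.sq_sqrt hpos.le
  have hs0 : √(1 + p (q 0) ^ 2) ≠ 0 := by positivity
  simp only [Matrix.diagonal, Matrix.of_apply]
  generalize √(1 + p (q 0) ^ 2) = w at hs hs0 ⊢
  rw [← hs]
  simp
  field_simp
  ring

end Bubble

/-! ### Parity and monotonicity of φ -/

/-- A positive even smooth function `f` on `(-s₀, s₀)` such that `log f` is strictly convex there
and `log ∫ f` is strictly concave on `(0, s₀)`. -/
structure ConvexTube (f : ℝ → ℝ) (s₀ : ℝ) : Prop where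
  s₀_pos : 0 < s₀
  smooth : ContDiffOn ℝ ∞ f (Ioo (-s₀) s₀)
  pos : ∀ s ∈ Ioo (-s₀) s₀, 0 < f s
  even : ∀ s ∈ Ioo (-s₀) s₀, f (-s) = f s
  concave_logF : ∀ s ∈ Ioo 0 s₀, deriv (deriv (fun t => Real.log (primF f t))) s < 0
  convex_logf : ∀ s ∈ Ioo (-s₀) s₀, 0 < deriv (deriv (fun t => Real.log (f t))) s

/-- The logarithmic derivative `f' / f`. -/
def logSlope (f : ℝ → ℝ) (s : ℝ) : ℝ := deriv f s / f s

/-- The derivative of `φ = F / f`. -/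
def dphi (f : ℝ → ℝ) (s : ℝ) : ℝ := 1 - phiF f s * logSlope f s

theorem phiF_zero (f : ℝ → ℝ) : phiF f 0 = 0 := by simp [phiF, primF]

theorem neg_mem_symm_Ioo {s₀ s : ℝ} (hs : s ∈ Ioo (-s₀) s₀) : -s ∈ Ioo (-s₀) s₀ :=
  ⟨by linarith [hs.2], by linarith [hs.1]⟩

theorem mem_symm_Ioo {s₀ s : ℝ} (hs : s ∈ Ioo 0 s₀) : s ∈ Ioo (-s₀) s₀ :=
  ⟨by linarith [hs.1, hs.2], hs.2⟩

theorem Icc_subset_symm_Ioo {s₀ s : ℝ} (hs : s < s₀) : Icc (-s) s ⊆ Ioo (-s₀) s₀ :=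
  fun _ hx => ⟨by linarith [hx.1], by linarith [hx.2]⟩

namespace ConvexTube

variable {f : ℝ → ℝ} {s₀ : ℝ} (H : ConvexTube f s₀)
include H

theorem zero_mem : (0 : ℝ) ∈ Ioo (-s₀) s₀ := ⟨by linarith [H.s₀_pos], H.s₀_pos⟩

theorem contDiffAt {s : ℝ} (hs : s ∈ Ioo (-s₀) s₀) : ContDiffAt ℝ ∞ f s :=
  H.smooth.contDiffAt (Ioo_mem_nhds hs.1 hs.2)

theorem differentiableAt {s : ℝ} (hs : s ∈ Ioo (-s₀) s₀) : DifferentiableAt ℝ f s :=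
  (H.contDiffAt hs).differentiableAt (by simp)

theorem hasStrictDerivAt {s : ℝ} (hs : s ∈ Ioo (-s₀) s₀) : HasStrictDerivAt f (deriv f s) s :=
  (H.contDiffAt hs).hasStrictDerivAt (by simp)

theorem contDiffOn_deriv : ContDiffOn ℝ ∞ (deriv f) (Ioo (-s₀) s₀) :=
  ((contDiffOn_infty_iff_deriv_of_isOpen isOpen_Ioo).1 H.smooth).2

theorem contDiffOn_logSlope : ContDiffOn ℝ ∞ (logSlope f) (Ioo (-s₀) s₀) :=
  H.contDiffOn_deriv.div H.smooth fun s hs => (H.pos s hs).ne'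

theorem hasDerivAt_logSlope {s : ℝ} (hs : s ∈ Ioo (-s₀) s₀) :
    HasDerivAt (logSlope f) (deriv (logSlope f) s) s :=
  ((H.contDiffOn_logSlope.contDiffAt (Ioo_mem_nhds hs.1 hs.2)).differentiableAt (by simp)).hasDerivAt

theorem continuousOn_deriv_logSlope : ContinuousOn (deriv (logSlope f)) (Ioo (-s₀) s₀) :=
  ((contDiffOn_infty_iff_deriv_of_isOpen isOpen_Ioo).1 H.contDiffOn_logSlope).2.continuousOn

theorem deriv_logSlope_pos {s : ℝ} (hs : s ∈ Ioo (-s₀) s₀) : 0 < deriv (logSlope f) s := by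
  have h := H.convex_logf s hs
  have he : deriv (fun t => Real.log (f t)) =ᶠ[𝓝 s] logSlope f := by
    filter_upwards [Ioo_mem_nhds hs.1 hs.2] with t ht
    exact ((H.differentiableAt ht).hasDerivAt.log (H.pos t ht).ne').deriv
  rwa [he.deriv_eq] at h

theorem uIcc_subset {s : ℝ} (hs : s ∈ Ioo (-s₀) s₀) : uIcc 0 s ⊆ Ioo (-s₀) s₀ :=
  ordConnected_Ioo.uIcc_subset H.zero_mem hs

theorem hasStrictDerivAt_primF {s : ℝ} (hs : s ∈ Ioo (-s₀) s₀) :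
    HasStrictDerivAt (primF f) (f s) s :=
  intervalIntegral.integral_hasStrictDerivAt_right
    ((H.smooth.continuousOn.mono (H.uIcc_subset hs)).intervalIntegrable)
    (H.smooth.continuousOn.stronglyMeasurableAtFilter isOpen_Ioo s hs)
    (H.differentiableAt hs).continuousAt

theorem hasStrictDerivAt_phiF {s : ℝ} (hs : s ∈ Ioo (-s₀) s₀) :
    HasStrictDerivAt (phiF f) (dphi f s) s := by
  have h0 := (H.pos s hs).ne'
  refine ((H.hasStrictDerivAt_primF hs).div (H.hasStrictDerivAt hs) h0).congr_deriv ?_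
  rw [dphi, logSlope, phiF]
  field_simp

theorem hasDerivAt_phiF {s : ℝ} (hs : s ∈ Ioo (-s₀) s₀) : HasDerivAt (phiF f) (dphi f s) s :=
  (H.hasStrictDerivAt_phiF hs).hasDerivAt

theorem continuousOn_phiF : ContinuousOn (phiF f) (Ioo (-s₀) s₀) :=
  fun _ hs => (H.hasDerivAt_phiF hs).continuousAt.continuousWithinAt

theorem hasDerivAt_dphi {s : ℝ} (hs : s ∈ Ioo (-s₀) s₀) : HasDerivAt (dphi f)
    (-(dphi f s * logSlope f s + phiF f s * deriv (logSlope f) s)) s := by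
  refine (((H.hasDerivAt_phiF hs).mul (H.hasDerivAt_logSlope hs)).const_sub 1).congr_deriv ?_
  ring

theorem deriv_neg {s : ℝ} (hs : s ∈ Ioo (-s₀) s₀) : deriv f (-s) = -deriv f s := by
  have h1 : HasDerivAt (fun t => f (-t)) (deriv f (-s) * -1) s :=
    (H.differentiableAt (neg_mem_symm_Ioo hs)).hasDerivAt.comp s (hasDerivAt_neg s)
  have h2 : (fun t => f (-t)) =ᶠ[𝓝 s] f := by
    filter_upwards [Ioo_mem_nhds hs.1 hs.2] with t ht using H.even t ht
  have := h2.deriv_eq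
  rw [h1.deriv] at this
  linarith

theorem logSlope_neg {s : ℝ} (hs : s ∈ Ioo (-s₀) s₀) : logSlope f (-s) = -logSlope f s := by
  rw [logSlope, logSlope, H.deriv_neg hs, H.even s hs, neg_div]

theorem deriv_logSlope_neg {s : ℝ} (hs : s ∈ Ioo (-s₀) s₀) :
    deriv (logSlope f) (-s) = deriv (logSlope f) s := by
  have h1 : HasDerivAt (fun t => logSlope f (-t)) (deriv (logSlope f) (-s) * -1) s :=
    (H.hasDerivAt_logSlope (neg_mem_symm_Ioo hs)).comp s (hasDerivAt_neg s)
  have h2 : (fun t => logSlope f (-t)) =ᶠ[𝓝 s] fun t => -logSlope f t := by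
    filter_upwards [Ioo_mem_nhds hs.1 hs.2] with t ht using H.logSlope_neg ht
  have := h2.deriv_eq
  rw [h1.deriv, (H.hasDerivAt_logSlope hs).fun_neg.deriv] at this
  linarith

theorem primF_neg {s : ℝ} (hs : s ∈ Ioo (-s₀) s₀) : primF f (-s) = -primF f s := by
  have h := intervalIntegral.integral_comp_neg f (a := 0) (b := s)
  rw [neg_zero] at h
  have h2 : ∫ t in (0 : ℝ)..s, f (-t) = ∫ t in (0 : ℝ)..s, f t :=
    intervalIntegral.integral_congr fun t ht => H.even t (H.uIcc_subset hs ht)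
  rw [primF, primF, intervalIntegral.integral_symm, ← h, h2]

theorem phiF_neg {s : ℝ} (hs : s ∈ Ioo (-s₀) s₀) : phiF f (-s) = -phiF f s := by
  rw [phiF, phiF, H.primF_neg hs, H.even s hs, neg_div]

theorem dphi_neg {s : ℝ} (hs : s ∈ Ioo (-s₀) s₀) : dphi f (-s) = dphi f s := by
  rw [dphi, dphi, H.phiF_neg hs, H.logSlope_neg hs]
  ring

theorem primF_pos {s : ℝ} (hs : s ∈ Ioo 0 s₀) : 0 < primF f s := by
  have hs' : s ∈ Ioo (-s₀) s₀ := ⟨by linarith [hs.1, hs.2], hs.2⟩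
  refine intervalIntegral.intervalIntegral_pos_of_pos_on
    ((H.smooth.continuousOn.mono (H.uIcc_subset hs')).intervalIntegrable) (fun t ht => ?_) hs.1
  exact H.pos t ⟨by linarith [ht.1, hs.1, hs.2], by linarith [ht.2, hs.2]⟩

theorem phiF_pos {s : ℝ} (hs : s ∈ Ioo 0 s₀) : 0 < phiF f s :=
  div_pos (H.primF_pos hs) (H.pos s ⟨by linarith [hs.1, hs.2], hs.2⟩)

/-- Since (log F)' = 1/φ, the second derivative is -φ'/φ². -/
theorem dphi_pos_of_pos {s : ℝ} (hs : s ∈ Ioo 0 s₀) : 0 < dphi f s := by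
  have hs' : s ∈ Ioo (-s₀) s₀ := ⟨by linarith [hs.1, hs.2], hs.2⟩
  have h := H.concave_logF s hs
  have he : deriv (fun t => Real.log (primF f t)) =ᶠ[𝓝 s] fun t => f t / primF f t := by
    filter_upwards [Ioo_mem_nhds hs.1 hs.2] with t ht
    exact ((H.hasStrictDerivAt_primF ⟨by linarith [ht.1, ht.2], ht.2⟩).hasDerivAt.log
      (H.primF_pos ht).ne').deriv
  have hF := H.primF_pos hs
  have hf := H.pos s hs'
  have hd := (H.differentiableAt hs').hasDerivAt.fun_div (H.hasStrictDerivAt_primF hs').hasDerivAt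
    hF.ne'
  rw [he.deriv_eq, hd.deriv, div_neg_iff] at h
  have h' : deriv f s * primF f s - f s * f s < 0 := by
    rcases h with h | h
    · exact absurd h.2 (not_lt.2 (sq_nonneg _))
    · exact h.1
  have : dphi f s = (f s * f s - deriv f s * primF f s) / f s ^ 2 := by
    rw [dphi, phiF, logSlope]
    field_simp
  rw [this]
  exact div_pos (by linarith) (by positivity)

theorem dphi_pos {s : ℝ} (hs : s ∈ Ioo (-s₀) s₀) : 0 < dphi f s := by
  rcases lt_trichotomy s 0 with h | rfl | h
  · rw [← H.dphi_neg hs]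
    exact H.dphi_pos_of_pos ⟨by linarith, (neg_mem_symm_Ioo hs).2⟩
  · simp [dphi, phiF_zero f]
  · exact H.dphi_pos_of_pos ⟨h, hs.2⟩

theorem logSlope_pos {s : ℝ} (hs : s ∈ Ioo 0 s₀) : 0 < logSlope f s := by
  have h0 : logSlope f 0 = 0 := by
    have := H.logSlope_neg H.zero_mem
    rw [neg_zero] at this
    linarith
  have hm : StrictMonoOn (logSlope f) (Ioo (-s₀) s₀) :=
    strictMonoOn_of_deriv_pos (convex_Ioo _ _) H.contDiffOn_logSlope.continuousOn
      (fun x hx => by rw [interior_Ioo] at hx; exact H.deriv_logSlope_pos hx)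
  rw [← h0]
  exact hm H.zero_mem ⟨by linarith [hs.1, hs.2], hs.2⟩ hs.1

/-- Both factors are odd and positive for s > 0. The purpose is the bound φ' ≤ 1, used for the
angular modes. -/
theorem phiF_mul_logSlope_nonneg {s : ℝ} (hs : s ∈ Ioo (-s₀) s₀) :
    0 ≤ phiF f s * logSlope f s := by
  rcases lt_trichotomy s 0 with h | rfl | h
  · have hs' : -s ∈ Ioo 0 s₀ := ⟨by linarith, (neg_mem_symm_Ioo hs).2⟩
    have h1 := mul_pos (H.phiF_pos hs') (H.logSlope_pos hs')
    rw [H.phiF_neg hs, H.logSlope_neg hs] at h1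
    linarith
  · simp [phiF_zero f]
  · exact (mul_pos (H.phiF_pos ⟨h, hs.2⟩) (H.logSlope_pos ⟨h, hs.2⟩)).le

theorem strictMonoOn_phiF : StrictMonoOn (phiF f) (Ioo (-s₀) s₀) :=
  strictMonoOn_of_deriv_pos (convex_Ioo _ _) H.continuousOn_phiF
    (fun x hx => by
      rw [interior_Ioo] at hx
      rw [(H.hasDerivAt_phiF hx).deriv]
      exact H.dphi_pos hx)

end ConvexTube

/-! ### The angle coordinate and the Sturm–Liouville data of a bubble -/

/-- The coordinate `s` as a function of the angle `σ` given by `φ(s) = φ(s₁) sin σ`. -/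
def angleToS (f : ℝ → ℝ) (s₀ s₁ σ : ℝ) : ℝ :=
  Function.invFunOn (phiF f) (Ioo (-s₀) s₀) (phiF f s₁ * sin σ)

/-- The function `-φ'' φ(s₁) / φ'³`. -/
def bend (f : ℝ → ℝ) (s₁ s : ℝ) : ℝ :=
  (dphi f s * logSlope f s + phiF f s * deriv (logSlope f) s) * phiF f s₁ / dphi f s ^ 3

/-- The height of the profile curve as a function of the angle. -/
def angleToY (f : ℝ → ℝ) (s₀ s₁ σ : ℝ) : ℝ :=
  ∫ τ in σ..(π / 2), phiF f s₁ * sin τ / dphi f (angleToS f s₀ s₁ τ)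

namespace ConvexTube

variable {f : ℝ → ℝ} {s₀ s₁ : ℝ} (H : ConvexTube f s₀) (h₁ : s₁ ∈ Ioo 0 s₀)
include H

theorem angleToS_eq_of {s σ : ℝ} (hs : s ∈ Ioo (-s₀) s₀) (h : phiF f s = phiF f s₁ * sin σ) :
    angleToS f s₀ s₁ σ = s := by
  rw [angleToS, ← h]
  exact H.strictMonoOn_phiF.injOn.leftInvOn_invFunOn hs

include h₁

/-- φ is odd and continuous, so it takes on [-s₁, s₁] every value between ± φ(s₁). Hence `angleToS`
never meets the default value of `Function.invFunOn`. -/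
theorem exists_phiF_eq (σ : ℝ) : ∃ s ∈ Icc (-s₁) s₁, phiF f s = phiF f s₁ * sin σ := by
  have hφ := H.phiF_pos h₁
  have h := intermediate_value_Icc (f := phiF f) (a := -s₁) (b := s₁) (by linarith [h₁.1])
    (H.continuousOn_phiF.mono (Icc_subset_symm_Ioo h₁.2))
  rw [H.phiF_neg (mem_symm_Ioo h₁)] at h
  exact h ⟨by nlinarith [neg_one_le_sin σ], by nlinarith [sin_le_one σ]⟩

theorem angleToS_mem_Icc (σ : ℝ) : angleToS f s₀ s₁ σ ∈ Icc (-s₁) s₁ := by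
  obtain ⟨s, hs, he⟩ := H.exists_phiF_eq h₁ σ
  rwa [H.angleToS_eq_of (Icc_subset_symm_Ioo h₁.2 hs) he]

theorem angleToS_mem (σ : ℝ) : angleToS f s₀ s₁ σ ∈ Ioo (-s₀) s₀ :=
  Icc_subset_symm_Ioo h₁.2 (H.angleToS_mem_Icc h₁ σ)

theorem phiF_angleToS (σ : ℝ) : phiF f (angleToS f s₀ s₁ σ) = phiF f s₁ * sin σ := by
  obtain ⟨s, hs, he⟩ := H.exists_phiF_eq h₁ σ
  rw [H.angleToS_eq_of (Icc_subset_symm_Ioo h₁.2 hs) he, he]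

theorem angleToS_neg (σ : ℝ) : angleToS f s₀ s₁ (-σ) = -angleToS f s₀ s₁ σ := by
  have hm := H.angleToS_mem h₁ σ
  refine H.angleToS_eq_of (neg_mem_symm_Ioo hm) ?_
  rw [H.phiF_neg hm, H.phiF_angleToS h₁, sin_neg]
  ring

/-- Since sin stays in [-1, 1], the angle coordinate makes sense on all of ℝ; it folds smoothly at ±
π/2, and no one-sided derivatives are needed at the ends. -/
theorem hasDerivAt_angleToS (σ : ℝ) : HasDerivAt (angleToS f s₀ s₁)
    (phiF f s₁ * cos σ / dphi f (angleToS f s₀ s₁ σ)) σ := by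
  have hm := H.angleToS_mem h₁ σ
  have hinv : HasStrictDerivAt (Function.invFunOn (phiF f) (Ioo (-s₀) s₀))
      (dphi f (angleToS f s₀ s₁ σ))⁻¹ (phiF f (angleToS f s₀ s₁ σ)) := by
    refine (H.hasStrictDerivAt_phiF hm).to_local_left_inverse (H.dphi_pos hm).ne' ?_
    filter_upwards [Ioo_mem_nhds hm.1 hm.2] with t ht
    exact H.strictMonoOn_phiF.injOn.leftInvOn_invFunOn ht
  rw [H.phiF_angleToS h₁] at hinv
  refine (hinv.hasDerivAt.comp σ ((hasDerivAt_sin σ).const_mul (phiF f s₁))).congr_deriv ?_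
  ring

theorem continuous_angleToS : Continuous (angleToS f s₀ s₁) :=
  continuous_iff_continuousAt.2 fun σ => (H.hasDerivAt_angleToS h₁ σ).continuousAt

theorem continuous_comp_angleToS {g : ℝ → ℝ} (hg : ContinuousOn g (Ioo (-s₀) s₀)) :
    Continuous fun σ => g (angleToS f s₀ s₁ σ) :=
  hg.comp_continuous (H.continuous_angleToS h₁) (H.angleToS_mem h₁)

theorem continuous_dphi_angleToS : Continuous fun σ => dphi f (angleToS f s₀ s₁ σ) :=
  H.continuous_comp_angleToS h₁
    fun _ hs => (H.hasDerivAt_dphi hs).continuousAt.continuousWithinAt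

theorem continuous_deriv_angleToY :
    Continuous fun σ => phiF f s₁ * sin σ / dphi f (angleToS f s₀ s₁ σ) :=
  Continuous.div (by fun_prop) (H.continuous_dphi_angleToS h₁)
    fun σ => (H.dphi_pos (H.angleToS_mem h₁ σ)).ne'

theorem hasDerivAt_angleToY (σ : ℝ) : HasDerivAt (angleToY f s₀ s₁)
    (-(phiF f s₁ * sin σ / dphi f (angleToS f s₀ s₁ σ))) σ :=
  have hc := H.continuous_deriv_angleToY h₁
  intervalIntegral.integral_hasDerivAt_left (hc.intervalIntegrable _ _)
    (hc.stronglyMeasurableAtFilter _ _) hc.continuousAt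

theorem angleToY_neg_pi_div_two : angleToY f s₀ s₁ (-(π / 2)) = 0 :=
  integral_symm_of_odd (fun τ => by
    rw [H.angleToS_neg h₁, H.dphi_neg (H.angleToS_mem h₁ τ), sin_neg]
    ring) _

theorem continuous_bend : Continuous fun σ => bend f s₁ (angleToS f s₀ s₁ σ) := by
  have h1 := H.continuous_dphi_angleToS h₁
  have h2 := H.continuous_comp_angleToS h₁ H.continuousOn_deriv_logSlope
  have h3 := H.continuous_comp_angleToS h₁ H.continuousOn_phiF
  have h4 := H.continuous_comp_angleToS h₁ H.contDiffOn_logSlope.continuousOn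
  exact Continuous.div (by fun_prop) (by fun_prop)
    fun σ => (pow_pos (H.dphi_pos (H.angleToS_mem h₁ σ)) 3).ne'

theorem bend_neg (σ : ℝ) :
    bend f s₁ (angleToS f s₀ s₁ (-σ)) = -bend f s₁ (angleToS f s₀ s₁ σ) := by
  have hm := H.angleToS_mem h₁ σ
  rw [H.angleToS_neg h₁, bend, bend, H.dphi_neg hm, H.logSlope_neg hm, H.phiF_neg hm,
    H.deriv_logSlope_neg hm]
  ring

theorem angleToS_nonneg {σ : ℝ} (hσ : σ ∈ Icc 0 (π / 2)) : 0 ≤ angleToS f s₀ s₁ σ := by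
  rw [← H.strictMonoOn_phiF.le_iff_le H.zero_mem (H.angleToS_mem h₁ σ), phiF_zero,
    H.phiF_angleToS h₁]
  exact mul_nonneg (H.phiF_pos h₁).le
    (sin_nonneg_of_nonneg_of_le_pi hσ.1 (by linarith [hσ.2, Real.pi_pos]))

theorem bend_nonneg {σ : ℝ} (hσ : σ ∈ Icc 0 (π / 2)) :
    0 ≤ bend f s₁ (angleToS f s₀ s₁ σ) := by
  have hm := H.angleToS_mem h₁ σ
  have hd := H.dphi_pos hm
  have hφ := H.phiF_pos h₁
  have h2 := (H.deriv_logSlope_pos hm).le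
  rcases (H.angleToS_nonneg h₁ hσ).eq_or_lt with h | h
  · have h0 : logSlope f 0 = 0 := by
      have := H.logSlope_neg H.zero_mem
      rw [neg_zero] at this
      linarith
    simp [← h, bend, h0, phiF_zero]
  · have h3 := H.logSlope_pos ⟨h, hm.2⟩
    have h4 := H.phiF_pos ⟨h, hm.2⟩
    unfold bend
    positivity

/-- For negative σ the integral over [σ, -σ] vanishes by oddness, leaving an interval on which the
integrand is nonnegative. -/
theorem integral_bend_nonneg {σ : ℝ} (hσ : σ ∈ Icc (-(π / 2)) (π / 2)) :
    0 ≤ ∫ τ in σ..(π / 2), bend f s₁ (angleToS f s₀ s₁ τ) := by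
  have hpos : ∀ σ ∈ Icc 0 (π / 2), 0 ≤ ∫ τ in σ..(π / 2), bend f s₁ (angleToS f s₀ s₁ τ) :=
    fun σ hσ => intervalIntegral.integral_nonneg hσ.2
      fun τ hτ => H.bend_nonneg h₁ ⟨hσ.1.trans hτ.1, hτ.2⟩
  rcases le_total 0 σ with h | h
  · exact hpos σ ⟨h, hσ.2⟩
  · have hc := H.continuous_bend h₁
    have h0 := integral_symm_of_odd
      (g := fun τ => bend f s₁ (angleToS f s₀ s₁ τ)) (H.bend_neg h₁) (-σ)
    rw [neg_neg] at h0
    rw [← intervalIntegral.integral_add_adjacent_intervals (b := -σ)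
      (hc.intervalIntegrable _ _) (hc.intervalIntegrable _ _), h0, zero_add]
    exact hpos (-σ) ⟨by linarith, by linarith [hσ.1]⟩

theorem continuous_T :
    Continuous fun σ => f (angleToS f s₀ s₁ σ) * phiF f s₁ / dphi f (angleToS f s₀ s₁ σ) := by
  have h1 := H.continuous_comp_angleToS h₁ H.smooth.continuousOn
  exact Continuous.div (h1.mul continuous_const) (H.continuous_dphi_angleToS h₁)
    fun σ => (H.dphi_pos (H.angleToS_mem h₁ σ)).ne'

/-- The Sturm-Liouville data of the bubble in the coordinate `σ`. -/
def zeroModeData : ZeroModeData where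
  A σ := f (angleToS f s₀ s₁ σ) * dphi f (angleToS f s₀ s₁ σ) / phiF f s₁
  e σ := deriv (logSlope f) (angleToS f s₀ s₁ σ) *
    (f (angleToS f s₀ s₁ σ) * phiF f s₁ / dphi f (angleToS f s₀ s₁ σ))
  T σ := f (angleToS f s₀ s₁ σ) * phiF f s₁ / dphi f (angleToS f s₀ s₁ σ)
  n σ := (dphi f (angleToS f s₀ s₁ σ))⁻¹
  w σ := bend f s₁ (angleToS f s₀ s₁ σ)
  -- Moving Λ = φ(s₁) at fixed σ changes s by sin σ / φ' and, after an integration by parts, the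
  -- height by cos σ / φ' plus this integral. The normal component of that motion is n + cos · W.
  W σ := ∫ τ in σ..(π / 2), bend f s₁ (angleToS f s₀ s₁ τ)
  -- Minus the derivative of the mean curvature 1/Λ with respect to Λ.
  k := (phiF f s₁ ^ 2)⁻¹
  A_pos σ := div_pos (mul_pos (H.pos _ (H.angleToS_mem h₁ σ)) (H.dphi_pos (H.angleToS_mem h₁ σ)))
    (H.phiF_pos h₁)
  e_pos σ := mul_pos (H.deriv_logSlope_pos (H.angleToS_mem h₁ σ))
    (div_pos (mul_pos (H.pos _ (H.angleToS_mem h₁ σ)) (H.phiF_pos h₁))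
      (H.dphi_pos (H.angleToS_mem h₁ σ)))
  T_pos σ := div_pos (mul_pos (H.pos _ (H.angleToS_mem h₁ σ)) (H.phiF_pos h₁))
      (H.dphi_pos (H.angleToS_mem h₁ σ))
  n_pos σ := inv_pos.2 (H.dphi_pos (H.angleToS_mem h₁ σ))
  k_pos := inv_pos.2 (pow_pos (H.phiF_pos h₁) 2)
  continuous_e := (H.continuous_comp_angleToS h₁ H.continuousOn_deriv_logSlope).mul
    (H.continuous_T h₁)
  continuous_T := H.continuous_T h₁
  continuous_w := H.continuous_bend h₁
  A_even σ := by
    have hm := H.angleToS_mem h₁ σ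
    rw [H.angleToS_neg h₁, H.even _ hm, H.dphi_neg hm]
  e_even σ := by
    have hm := H.angleToS_mem h₁ σ
    rw [H.angleToS_neg h₁, H.even _ hm, H.dphi_neg hm, H.deriv_logSlope_neg hm]
  T_even σ := by
    have hm := H.angleToS_mem h₁ σ
    rw [H.angleToS_neg h₁, H.even _ hm, H.dphi_neg hm]
  n_even σ := by
    have hm := H.angleToS_mem h₁ σ
    rw [H.angleToS_neg h₁, H.dphi_neg hm]
  -- In (fφ')' = f'φ' + fφ'' the terms with f' cancel, leaving -fφ (log f)''; then φ = Λ sin σ and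
  -- ds/dσ = Λ cos σ / φ'.
  hasDerivAt_A σ := by
    have hm := H.angleToS_mem h₁ σ
    have hS := H.hasDerivAt_angleToS h₁ σ
    have h0 := (H.pos _ hm).ne'
    have hd := (H.dphi_pos hm).ne'
    have hφ := (H.phiF_pos h₁).ne'
    refine ((((H.differentiableAt hm).hasDerivAt.comp σ hS).mul
      ((H.hasDerivAt_dphi hm).comp σ hS)).div_const (phiF f s₁)).congr_deriv ?_
    simp only [Function.comp, H.phiF_angleToS h₁, logSlope]
    field_simp
    ring
  hasDerivAt_n σ := by
    have hm := H.angleToS_mem h₁ σ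
    have hd := (H.dphi_pos hm).ne'
    refine (((H.hasDerivAt_dphi hm).comp σ (H.hasDerivAt_angleToS h₁ σ)).inv hd).congr_deriv ?_
    simp only [Function.comp, bend]
    field_simp
  hasDerivAt_W σ :=
    have hc := H.continuous_bend h₁
    intervalIntegral.integral_hasDerivAt_left (hc.intervalIntegrable _ _)
      (hc.stronglyMeasurableAtFilter _ _) hc.continuousAt
  W_nonneg _ hσ := H.integral_bend_nonneg h₁ hσ
  W_left := integral_symm_of_odd
      (g := fun τ => bend f s₁ (angleToS f s₀ s₁ τ)) (H.bend_neg h₁) _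
  W_right := by simp
  forced σ := by
    have hd := (H.dphi_pos (H.angleToS_mem h₁ σ)).ne'
    have hφ := (H.phiF_pos h₁).ne'
    -- After clearing denominators the equation reduces to this relation, φ' = 1 - φ f'/f at φ = Λ
    -- sin σ.
    have hid : dphi f (angleToS f s₀ s₁ σ) =
        1 - phiF f s₁ * sin σ * logSlope f (angleToS f s₀ s₁ σ) := by
      rw [dphi, H.phiF_angleToS h₁]
    simp only [bend, H.phiF_angleToS h₁]
    field_simp
    linear_combination (f (angleToS f s₀ s₁ σ) * dphi f (angleToS f s₀ s₁ σ)) * hid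

end ConvexTube

/-! ### The profile curve in the angle coordinate -/

/-- The slope of the profile curve. -/
def profileSlope (f : ℝ → ℝ) (s₁ s : ℝ) : ℝ := -(phiF f s / √(phiF f s₁ ^ 2 - phiF f s ^ 2))

namespace ConvexTube

variable {f : ℝ → ℝ} {s₀ s₁ : ℝ} (H : ConvexTube f s₀) (h₁ : s₁ ∈ Ioo 0 s₀)
include H

theorem angleToS_zero : angleToS f s₀ s₁ 0 = 0 :=
  H.angleToS_eq_of H.zero_mem (by simp [phiF_zero])

include h₁

theorem phiF_sq_lt {s : ℝ} (hs : s ∈ Ioo (-s₁) s₁) : phiF f s ^ 2 < phiF f s₁ ^ 2 := by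
  have hm := Icc_subset_symm_Ioo h₁.2 (Ioo_subset_Icc_self hs)
  have hm₁ := mem_symm_Ioo h₁
  have h2 := H.strictMonoOn_phiF hm hm₁ hs.2
  have h3 := H.strictMonoOn_phiF (neg_mem_symm_Ioo hm₁) hm hs.1
  rw [H.phiF_neg hm₁] at h3
  exact sq_lt_sq' h3 h2

theorem continuousOn_profileSlope : ContinuousOn (profileSlope f s₁) (Ioo (-s₁) s₁) := by
  have h := H.continuousOn_phiF.mono
    (Ioo_subset_Icc_self.trans (Icc_subset_symm_Ioo h₁.2))
  refine (h.div (Real.continuous_sqrt.comp_continuousOn (continuousOn_const.sub (h.pow 2)))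
    fun s hs => ?_).neg
  exact (Real.sqrt_pos.2 (sub_pos.2 (H.phiF_sq_lt h₁ hs))).ne'

theorem hasDerivAt_profile {s : ℝ} (hs : s ∈ Ioo (-s₁) s₁) :
    HasDerivAt (profile f s₁) (profileSlope f s₁ s) s := by
  have hc := (H.continuousOn_profileSlope h₁).neg
  have h0 : (0 : ℝ) ∈ Ioo (-s₁) s₁ := ⟨by linarith [h₁.1], h₁.1⟩
  have hcs := hc.continuousAt (Ioo_mem_nhds hs.1 hs.2)
  have := (intervalIntegral.integral_hasDerivAt_right
    ((hc.mono (ordConnected_Ioo.uIcc_subset h0 hs)).intervalIntegrable)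
    (hc.stronglyMeasurableAtFilter isOpen_Ioo s hs) hcs).neg.sub_const (profileU f s₁ s₁)
  refine (this.congr_deriv (neg_neg _)).congr_of_eventuallyEq (Eventually.of_forall fun t => ?_)
  simp [profile, profileU, profileSlope]

theorem angleToS_mem_Ioo {σ : ℝ} (hσ : σ ∈ Ioo (-(π / 2)) (π / 2)) :
    angleToS f s₀ s₁ σ ∈ Ioo (-s₁) s₁ := by
  have hm := H.angleToS_mem h₁ σ
  have hm₁ := mem_symm_Ioo h₁
  have hφ := H.phiF_pos h₁
  have hs1 : sin σ < 1 := by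
    rw [← sin_pi_div_two]
    exact sin_lt_sin_of_lt_of_le_pi_div_two hσ.1.le le_rfl hσ.2
  have hs2 : -1 < sin σ := by
    rw [← sin_pi_div_two, ← sin_neg]
    exact sin_lt_sin_of_lt_of_le_pi_div_two le_rfl hσ.2.le hσ.1
  constructor
  · rw [← H.strictMonoOn_phiF.lt_iff_lt (neg_mem_symm_Ioo hm₁) hm, H.phiF_neg hm₁,
      H.phiF_angleToS h₁]
    nlinarith
  · rw [← H.strictMonoOn_phiF.lt_iff_lt hm hm₁, H.phiF_angleToS h₁]
    nlinarith

theorem sqrt_angleToS {σ : ℝ} (hσ : σ ∈ Ioo (-(π / 2)) (π / 2)) :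
    √(phiF f s₁ ^ 2 - phiF f (angleToS f s₀ s₁ σ) ^ 2) = phiF f s₁ * cos σ := by
  rw [H.phiF_angleToS h₁, ← Real.sqrt_sq (mul_pos (H.phiF_pos h₁) (cos_pos_of_mem_Ioo hσ)).le]
  congr 1
  linear_combination (-(phiF f s₁ ^ 2)) * sin_sq_add_cos_sq σ

theorem profileSlope_angleToS {σ : ℝ} (hσ : σ ∈ Ioo (-(π / 2)) (π / 2)) :
    profileSlope f s₁ (angleToS f s₀ s₁ σ) = -(sin σ / cos σ) := by
  have hφ := (H.phiF_pos h₁).ne'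
  have hc := (cos_pos_of_mem_Ioo hσ).ne'
  rw [profileSlope, H.sqrt_angleToS h₁ hσ, H.phiF_angleToS h₁]
  field_simp

theorem one_add_profileSlope_sq {σ : ℝ} (hσ : σ ∈ Ioo (-(π / 2)) (π / 2)) :
    1 + profileSlope f s₁ (angleToS f s₀ s₁ σ) ^ 2 = (cos σ ^ 2)⁻¹ := by
  have hc := (cos_pos_of_mem_Ioo hσ).ne'
  rw [H.profileSlope_angleToS h₁ hσ]
  field_simp
  linear_combination sin_sq_add_cos_sq σ

theorem sqrt_one_add_profileSlope_sq {σ : ℝ} (hσ : σ ∈ Ioo (-(π / 2)) (π / 2)) :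
    √(1 + profileSlope f s₁ (angleToS f s₀ s₁ σ) ^ 2) = (cos σ)⁻¹ := by
  rw [H.one_add_profileSlope_sq h₁ hσ, Real.sqrt_inv, Real.sqrt_sq (cos_pos_of_mem_Ioo hσ).le]

/-- Together with 1 + p² = 1/cos², this says that the curvature of the profile is -φ'/Λ; its square
times T is A, the negative part of the potential V. -/
theorem hasDerivAt_profileSlope {σ : ℝ} (hσ : σ ∈ Ioo (-(π / 2)) (π / 2)) :
    HasDerivAt (profileSlope f s₁)
      (-(dphi f (angleToS f s₀ s₁ σ) / (phiF f s₁ * cos σ ^ 3))) (angleToS f s₀ s₁ σ) := by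
  have hm := H.angleToS_mem h₁ σ
  have hφ := (H.phiF_pos h₁).ne'
  have hc := (cos_pos_of_mem_Ioo hσ).ne'
  have hd := H.hasDerivAt_phiF hm
  have hpos := sub_pos.2 (H.phiF_sq_lt h₁ (H.angleToS_mem_Ioo h₁ hσ))
  have hs := H.sqrt_angleToS h₁ hσ
  refine (hd.div (((hd.pow 2).const_sub (phiF f s₁ ^ 2)).sqrt hpos.ne')
    (Real.sqrt_pos.2 hpos).ne').neg.congr_deriv ?_
  simp only [Pi.pow_apply, hs]
  rw [H.phiF_angleToS h₁]
  field_simp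
  simp only [Nat.cast_ofNat, Nat.add_one_sub_one, pow_one]
  linear_combination (-2 * dphi f (angleToS f s₀ s₁ σ) * phiF f s₁) * sin_sq_add_cos_sq σ

theorem hasDerivAt_profile_angleToS {σ : ℝ} (hσ : σ ∈ Ioo (-(π / 2)) (π / 2)) :
    HasDerivAt (fun σ => profile f s₁ (angleToS f s₀ s₁ σ))
      (-(phiF f s₁ * sin σ / dphi f (angleToS f s₀ s₁ σ))) σ := by
  have hc := (cos_pos_of_mem_Ioo hσ).ne'
  have hd := (H.dphi_pos (H.angleToS_mem h₁ σ)).ne'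
  refine ((H.hasDerivAt_profile h₁ (H.angleToS_mem_Ioo h₁ hσ)).comp σ
    (H.hasDerivAt_angleToS h₁ σ)).congr_deriv ?_
  rw [H.profileSlope_angleToS h₁ hσ]
  field_simp

theorem angleToS_arcsin {s : ℝ} (hs : s ∈ Icc (-s₁) s₁) :
    angleToS f s₀ s₁ (arcsin (phiF f s / phiF f s₁)) = s := by
  have hm := Icc_subset_symm_Ioo h₁.2 hs
  have hm₁ := mem_symm_Ioo h₁
  have hφ := H.phiF_pos h₁
  refine H.angleToS_eq_of hm ?_
  have h2 := H.strictMonoOn_phiF.monotoneOn hm hm₁ hs.2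
  have h3 := H.strictMonoOn_phiF.monotoneOn (neg_mem_symm_Ioo hm₁) hm hs.1
  rw [H.phiF_neg hm₁] at h3
  rw [sin_arcsin]
  · field_simp
  · rw [le_div_iff₀ hφ]; linarith
  · rw [div_le_iff₀ hφ]; linarith

theorem arcsin_mem_Ioo {s : ℝ} (hs : s ∈ Ioo (-s₁) s₁) :
    arcsin (phiF f s / phiF f s₁) ∈ Ioo (-(π / 2)) (π / 2) := by
  have hφ := H.phiF_pos h₁
  have h2 := abs_lt_of_sq_lt_sq (H.phiF_sq_lt h₁ hs) hφ.le
  rw [abs_lt] at h2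
  constructor
  · rw [neg_pi_div_two_lt_arcsin, lt_div_iff₀ hφ]; linarith
  · rw [arcsin_lt_pi_div_two, div_lt_iff₀ hφ]; linarith

theorem injOn_angleToS : InjOn (angleToS f s₀ s₁) (Icc (-(π / 2)) (π / 2)) := by
  intro x hx y hy hxy
  have h := H.phiF_angleToS h₁ x
  rw [hxy, H.phiF_angleToS h₁] at h
  exact injOn_sin hx hy (mul_left_cancel₀ (H.phiF_pos h₁).ne' h.symm)

theorem image_angleToS_Ioo : angleToS f s₀ s₁ '' Ioo 0 (π / 2) = Ioo 0 s₁ := by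
  have hpi := Real.pi_pos
  apply Subset.antisymm
  · rintro _ ⟨σ, hσ, rfl⟩
    refine ⟨lt_of_le_of_ne (H.angleToS_nonneg h₁ (Ioo_subset_Icc_self hσ)) fun h => ?_,
      (H.angleToS_mem_Ioo h₁ ⟨by linarith [hσ.1], hσ.2⟩).2⟩
    rw [← H.angleToS_zero (s₁ := s₁)] at h
    exact hσ.1.ne (H.injOn_angleToS h₁ ⟨by linarith, by linarith⟩
      ⟨by linarith [hσ.1], hσ.2.le⟩ h)
  · intro s hs
    have hs' : s ∈ Ioo (-s₁) s₁ := ⟨by linarith [hs.1, hs.2], hs.2⟩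
    refine ⟨_, ⟨arcsin_pos.2 (div_pos (H.phiF_pos ⟨hs.1, hs.2.trans h₁.2⟩) (H.phiF_pos h₁)),
      (H.arcsin_mem_Ioo h₁ hs').2⟩, H.angleToS_arcsin h₁ (Ioo_subset_Icc_self hs')⟩

/-- The integral for the height is improper at s₁. The substitution s = s(σ) on the open interval
turns it into the integral of a continuous function. -/
theorem profile_zero : profile f s₁ 0 = angleToY f s₀ s₁ 0 := by
  have hpi := Real.pi_pos
  have hinj : InjOn (angleToS f s₀ s₁) (Ioo 0 (π / 2)) :=
    (H.injOn_angleToS h₁).mono (Ioo_subset_Icc_self.trans (Icc_subset_Icc_left (by linarith)))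
  have h0 : profileU f s₁ 0 = 0 := by simp [profileU]
  rw [profile, h0, profileU, zero_sub, neg_neg, angleToY,
    intervalIntegral.integral_of_le h₁.1.le, integral_Ioc_eq_integral_Ioo,
    ← H.image_angleToS_Ioo h₁, integral_image_eq_integral_abs_deriv_smul measurableSet_Ioo
      (fun σ _ => (H.hasDerivAt_angleToS h₁ σ).hasDerivWithinAt)
      hinj,
    intervalIntegral.integral_of_le (by linarith), integral_Ioc_eq_integral_Ioo]
  refine setIntegral_congr_fun measurableSet_Ioo fun σ hσ => ?_
  have hσ' : σ ∈ Ioo (-(π / 2)) (π / 2) := ⟨by linarith [hσ.1], hσ.2⟩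
  have hc := cos_pos_of_mem_Ioo hσ'
  have hφ := H.phiF_pos h₁
  have hd := H.dphi_pos (H.angleToS_mem h₁ σ)
  simp only [H.sqrt_angleToS h₁ hσ', smul_eq_mul]
  rw [H.phiF_angleToS h₁, abs_of_pos (by positivity)]
  field_simp

/-- Both sides have the same derivative in σ and agree at 0. The right side is smooth up to ± π/2,
where the slope of the profile is infinite. -/
theorem profile_angleToS {σ : ℝ} (hσ : σ ∈ Ioo (-(π / 2)) (π / 2)) :
    profile f s₁ (angleToS f s₀ s₁ σ) = angleToY f s₀ s₁ σ := by
  have hpi := Real.pi_pos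
  have hd : ∀ x ∈ Ioo (-(π / 2)) (π / 2), HasDerivAt
      (fun σ => profile f s₁ (angleToS f s₀ s₁ σ) - angleToY f s₀ s₁ σ) 0 x := fun x hx =>
    ((H.hasDerivAt_profile_angleToS h₁ hx).sub (H.hasDerivAt_angleToY h₁ x)).congr_deriv (sub_self _)
  have := isOpen_Ioo.is_const_of_deriv_eq_zero isPreconnected_Ioo
    (fun y hy => (hd y hy).differentiableAt.differentiableWithinAt)
    (fun y hy => (hd y hy).deriv) hσ (y := 0) ⟨by linarith, by linarith⟩
  simp only [H.angleToS_zero (s₁ := s₁), H.profile_zero h₁, sub_self] at this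
  linarith

/-- Integration over one half of the bubble in the angle coordinates. -/
theorem setIntegral_bubble_dom {h : (Fin 2 → ℝ) → ℝ} {k : ℝ → ℝ → ℝ} (ε : ℤˣ)
    (hk : Continuous (Function.uncurry k))
    (hh : ∀ σ ∈ Ioo (-(π / 2)) (π / 2), ∀ θ ∈ Ioo 0 (2 * π),
      phiF f s₁ * cos σ / dphi f (angleToS f s₀ s₁ σ) * h ![angleToS f s₀ s₁ σ, θ] = k σ θ) :
    ∫ q in (bubble f s₁ ε).dom, h q =
      ∫ σ in (-(π / 2))..(π / 2), ∫ θ in (0 : ℝ)..(2 * π), k σ θ := by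
  have hpi := Real.pi_pos
  set S := angleToS f s₀ s₁ with hS
  set S' : ℝ → ℝ := fun σ => phiF f s₁ * cos σ / dphi f (S σ) with hS'
  set box : Set (Fin 2 → ℝ) := {q | q 0 ∈ Ioo (-(π / 2)) (π / 2) ∧ q 1 ∈ Ioo 0 (2 * π)}
  set Ψ : (Fin 2 → ℝ) → (Fin 2 → ℝ) := fun q => ![S (q 0), q 1] with hΨ
  set Ψ' : (Fin 2 → ℝ) → (Fin 2 → ℝ) →L[ℝ] (Fin 2 → ℝ) := fun q =>
    LinearMap.toContinuousLinearMap (Matrix.toLin' (Matrix.diagonal ![S' (q 0), 1])) with hΨ'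
  have hbox : box = (MeasurableEquiv.finTwoArrow (α := ℝ)) ⁻¹'
      (Ioo (-(π / 2)) (π / 2) ×ˢ Ioo 0 (2 * π)) := rfl
  have hboxm : MeasurableSet box := by
    rw [hbox]
    exact MeasurableEquiv.finTwoArrow.measurable (measurableSet_Ioo.prod measurableSet_Ioo)
  have himg : (bubble f s₁ ε).dom = Ψ '' box := by
    apply Subset.antisymm
    · intro q hq
      refine ⟨![arcsin (phiF f (q 0) / phiF f s₁), q 1], ⟨H.arcsin_mem_Ioo h₁ hq.1, hq.2⟩, ?_⟩
      ext i
      fin_cases i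
      · simpa [hΨ] using H.angleToS_arcsin h₁ (Ioo_subset_Icc_self hq.1)
      · simp [hΨ]
    · rintro _ ⟨q, hq, rfl⟩
      exact ⟨H.angleToS_mem_Ioo h₁ hq.1, hq.2⟩
  have hinj : InjOn Ψ box := by
    intro x hx y hy hxy
    ext i
    fin_cases i
    · exact H.injOn_angleToS h₁ (Ioo_subset_Icc_self hx.1) (Ioo_subset_Icc_self hy.1)
        (congrFun hxy 0)
    · exact congrFun hxy 1
  have hder : ∀ q ∈ box, HasFDerivWithinAt Ψ (Ψ' q) box q := by
    intro q _
    refine (hasFDerivAt_pi'.2 fun i => ?_).hasFDerivWithinAt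
    fin_cases i
    · have := (H.hasDerivAt_angleToS h₁ (q 0)).hasFDerivAt.comp q
        (ContinuousLinearMap.proj (R := ℝ) (φ := fun _ : Fin 2 => ℝ) 0).hasFDerivAt
      refine this.congr_fderiv ?_
      ext v
      simp [hΨ', hS']
      ring
    · refine ((ContinuousLinearMap.proj (R := ℝ) (φ := fun _ : Fin 2 => ℝ) 1).hasFDerivAt
        (x := q)).congr_fderiv ?_
      ext v
      simp [hΨ']
  have hdet : ∀ q, (Ψ' q).det = S' (q 0) := fun q => by
    simp [hΨ', ContinuousLinearMap.det, Fin.prod_univ_two]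
  rw [himg, integral_image_eq_integral_abs_det_fderiv_smul volume hboxm hder hinj]
  have hcongr : ∀ q ∈ box, |(Ψ' q).det| • h (Ψ q) =
      Function.uncurry k (MeasurableEquiv.finTwoArrow q) := fun q hq => by
    have hpos : 0 < S' (q 0) := div_pos (mul_pos (H.phiF_pos h₁) (cos_pos_of_mem_Ioo hq.1))
      (H.dphi_pos (H.angleToS_mem h₁ _))
    rw [hdet, abs_of_pos hpos]
    exact hh _ hq.1 _ hq.2
  rw [setIntegral_congr_fun hboxm hcongr, hbox,
    (volume_preserving_finTwoArrow ℝ).setIntegral_preimage_emb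
      (MeasurableEquiv.measurableEmbedding _) (Function.uncurry k)]
  -- The Jacobian is already absorbed in k, which is continuous on the closed rectangle even when h
  -- is unbounded near s = ± s₁.
  have hint : IntegrableOn (Function.uncurry k) (Ioo (-(π / 2)) (π / 2) ×ˢ Ioo 0 (2 * π))
      (volume.prod volume) :=
    (hk.continuousOn.integrableOn_compact (isCompact_Icc.prod isCompact_Icc)).mono_set
      (prod_mono Ioo_subset_Icc_self Ioo_subset_Icc_self)
  rw [Measure.volume_eq_prod, setIntegral_prod _ hint,
    intervalIntegral.integral_of_le (by linarith), integral_Ioc_eq_integral_Ioo]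
  refine setIntegral_congr_fun measurableSet_Ioo fun σ _ => ?_
  rw [intervalIntegral.integral_of_le (by linarith), integral_Ioc_eq_integral_Ioo]
  rfl

end ConvexTube

/-! ### The index form in angle coordinates and the conclusion -/

/-- The point of the half `ε` of the bubble with angle coordinates `(σ, θ)`. -/
def anglePoint (f : ℝ → ℝ) (s₀ s₁ : ℝ) (ε : ℤˣ) (σ θ : ℝ) : Fin 3 → ℝ :=
  ![angleToS f s₀ s₁ σ, θ, ((ε : ℤ) : ℝ) * angleToY f s₀ s₁ σ]

theorem hasDerivAt_anglePoint_snd (f : ℝ → ℝ) (s₀ s₁ : ℝ) (ε : ℤˣ) (σ θ : ℝ) :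
    HasDerivAt (anglePoint f s₀ s₁ ε σ) ![0, 1, 0] θ := by
  refine hasDerivAt_pi.2 fun i => ?_
  fin_cases i
  · simpa [anglePoint] using hasDerivAt_const θ (angleToS f s₀ s₁ σ)
  · simpa [anglePoint] using hasDerivAt_id' θ
  · simpa [anglePoint] using hasDerivAt_const θ (((ε : ℤ) : ℝ) * angleToY f s₀ s₁ σ)

theorem isOpen_slab (s₀ : ℝ) : IsOpen {x : Fin 3 → ℝ | x 0 ∈ Ioo (-s₀) s₀} :=
  isOpen_Ioo.preimage (continuous_apply 0)

theorem hasFDerivAt_slab {s₀ : ℝ} {u : (Fin 3 → ℝ) → ℝ}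
    (hu : ContDiffOn ℝ ∞ u {x | x 0 ∈ Ioo (-s₀) s₀}) {x : Fin 3 → ℝ} (hx : x 0 ∈ Ioo (-s₀) s₀) :
    HasFDerivAt u (fderiv ℝ u x) x :=
  ((hu.contDiffAt ((isOpen_slab s₀).mem_nhds hx)).differentiableAt (by simp)).hasFDerivAt

namespace ConvexTube

variable {f : ℝ → ℝ} {s₀ s₁ : ℝ} (H : ConvexTube f s₀) (h₁ : s₁ ∈ Ioo 0 s₀)
include H h₁

theorem continuous_anglePoint (ε : ℤˣ) :
    Continuous fun z : ℝ × ℝ => anglePoint f s₀ s₁ ε z.1 z.2 := by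
  have h1 := H.continuous_angleToS h₁
  have h2 : Continuous (angleToY f s₀ s₁) :=
    continuous_iff_continuousAt.2 fun σ => (H.hasDerivAt_angleToY h₁ σ).continuousAt
  refine continuous_pi fun i => ?_
  fin_cases i <;> simp [anglePoint] <;> fun_prop

theorem hasDerivAt_anglePoint_fst (ε : ℤˣ) (σ θ : ℝ) :
    HasDerivAt (fun x => anglePoint f s₀ s₁ ε x θ)
      ![phiF f s₁ * cos σ / dphi f (angleToS f s₀ s₁ σ), 0,
        ((ε : ℤ) : ℝ) * -(phiF f s₁ * sin σ / dphi f (angleToS f s₀ s₁ σ))] σ := by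
  refine hasDerivAt_pi.2 fun i => ?_
  fin_cases i
  · simpa [anglePoint] using H.hasDerivAt_angleToS h₁ σ
  · simpa [anglePoint] using hasDerivAt_const σ θ
  · simpa [anglePoint] using (H.hasDerivAt_angleToY h₁ σ).const_mul ((ε : ℤ) : ℝ)

variable {u : (Fin 3 → ℝ) → ℝ} (hu : ContDiffOn ℝ ∞ u {x | x 0 ∈ Ioo (-s₀) s₀})

/-- The restriction of an ambient function to one half of the bubble. -/
def restrict (ε : ℤˣ) : CylinderFun where
  G σ θ := u (anglePoint f s₀ s₁ ε σ θ)
  Gs σ θ := fderiv ℝ u (anglePoint f s₀ s₁ ε σ θ)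
    ![phiF f s₁ * cos σ / dphi f (angleToS f s₀ s₁ σ), 0,
      ((ε : ℤ) : ℝ) * -(phiF f s₁ * sin σ / dphi f (angleToS f s₀ s₁ σ))]
  Gt σ θ := fderiv ℝ u (anglePoint f s₀ s₁ ε σ θ) ![0, 1, 0]
  continuous_G := hu.continuousOn.comp_continuous (H.continuous_anglePoint h₁ ε)
    fun z => H.angleToS_mem h₁ z.1
  continuous_Gs := by
    have h1 := (hu.continuousOn_fderiv_of_isOpen (isOpen_slab s₀) (by simp)).comp_continuous
      (H.continuous_anglePoint h₁ ε) fun z => H.angleToS_mem h₁ z.1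
    refine h1.clm_apply (continuous_pi fun i => ?_)
    have h2 := H.continuous_deriv_angleToY h₁
    have h3 : Continuous fun σ => phiF f s₁ * cos σ / dphi f (angleToS f s₀ s₁ σ) :=
      Continuous.div (by fun_prop) (H.continuous_dphi_angleToS h₁)
        fun σ => (H.dphi_pos (H.angleToS_mem h₁ σ)).ne'
    fin_cases i
    · exact h3.comp continuous_fst
    · exact continuous_const
    · exact continuous_const.mul (h2.comp continuous_fst).neg
  continuous_Gt := by
    have h1 := (hu.continuousOn_fderiv_of_isOpen (isOpen_slab s₀) (by simp)).comp_continuous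
      (H.continuous_anglePoint h₁ ε) fun z => H.angleToS_mem h₁ z.1
    exact h1.clm_apply continuous_const
  hasDerivAt_s σ θ := (hasFDerivAt_slab hu (H.angleToS_mem h₁ σ)).comp_hasDerivAt σ
    (H.hasDerivAt_anglePoint_fst h₁ ε σ θ)
  hasDerivAt_t σ θ := (hasFDerivAt_slab hu (H.angleToS_mem h₁ σ)).comp_hasDerivAt θ
    (hasDerivAt_anglePoint_snd f s₀ s₁ ε σ θ)

theorem bubble_map_angle {σ : ℝ} (hσ : σ ∈ Ioo (-(π / 2)) (π / 2)) (ε : ℤˣ) (θ : ℝ) :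
    (bubble f s₁ ε).map ![angleToS f s₀ s₁ σ, θ] = anglePoint f s₀ s₁ ε σ θ := by
  simp [bubble, anglePoint, H.profile_angleToS h₁ hσ]

/-- The factor 1/cos σ of the area density at the vertical tangent is cancelled by the cos σ in
ds/dσ. -/
theorem areaDensity_angle {σ : ℝ} (hσ : σ ∈ Ioo (-(π / 2)) (π / 2)) {c : ℝ} (hc : 0 < c)
    (ε : ℤˣ) (θ : ℝ) :
    phiF f s₁ * cos σ / dphi f (angleToS f s₀ s₁ σ) *
      (bubble f s₁ ε).areaDensity (tubeMetric f c) ![angleToS f s₀ s₁ σ, θ] =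
      c * (H.zeroModeData h₁).T σ := by
  have hm := H.angleToS_mem h₁ σ
  rw [bubble_areaDensity (p := profileSlope f s₁) (q := ![angleToS f s₀ s₁ σ, θ]) hc (H.pos _ hm)
    (H.hasDerivAt_profile h₁ (H.angleToS_mem_Ioo h₁ hσ))]
  simp only [Matrix.cons_val_zero, H.sqrt_one_add_profileSlope_sq h₁ hσ, zeroModeData]
  have := (cos_pos_of_mem_Ioo hσ).ne'
  field_simp

/-- With p² / (1 + p²) = sin²σ and profile curvature -φ'/Λ, the potential times T is e sin² - A. In
the gradient, 1/(1 + p²) = cos²σ cancels against (ds/dσ)⁻², so A is regular at the ends. -/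
theorem index_angle {σ : ℝ} (hσ : σ ∈ Ioo (-(π / 2)) (π / 2)) {c : ℝ} (hc : 0 < c)
    (ε : ℤˣ) (θ : ℝ) :
    phiF f s₁ * cos σ / dphi f (angleToS f s₀ s₁ σ) *
      (((bubble f s₁ ε).gradNormSq (tubeMetric f c) u ![angleToS f s₀ s₁ σ, θ] +
        (bubble f s₁ ε).jacobiPotential (tubeMetric f c) ![angleToS f s₀ s₁ σ, θ] *
          u ((bubble f s₁ ε).map ![angleToS f s₀ s₁ σ, θ]) ^ 2) *
      (bubble f s₁ ε).areaDensity (tubeMetric f c) ![angleToS f s₀ s₁ σ, θ]) =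
      c * ((H.zeroModeData h₁).A σ * (H.restrict h₁ hu ε).Gs σ θ ^ 2 +
        (H.zeroModeData h₁).T σ / (c ^ 2 * f (angleToS f s₀ s₁ σ) ^ 2) *
          (H.restrict h₁ hu ε).Gt σ θ ^ 2 +
        (H.zeroModeData h₁).V σ * (H.restrict h₁ hu ε).G σ θ ^ 2) := by
  have hm := H.angleToS_mem h₁ σ
  have hmI := H.angleToS_mem_Ioo h₁ hσ
  have hf := (H.pos _ hm).ne'
  have hcos := (cos_pos_of_mem_Ioo hσ).ne'
  have hd := (H.dphi_pos hm).ne'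
  have hφ := (H.phiF_pos h₁).ne'
  have hU : ∀ᶠ t in 𝓝 (angleToS f s₀ s₁ σ), HasDerivAt (profile f s₁) (profileSlope f s₁ t) t := by
    filter_upwards [Ioo_mem_nhds hmI.1 hmI.2] with t ht using H.hasDerivAt_profile h₁ ht
  have hmap := H.bubble_map_angle h₁ hσ ε θ
  have hF : HasFDerivAt u (fderiv ℝ u (anglePoint f s₀ s₁ ε σ θ))
      ((bubble f s₁ ε).map ![angleToS f s₀ s₁ σ, θ]) := by
    rw [hmap]
    exact hasFDerivAt_slab hu hm
  have hp0 : partialDeriv 0 (fun z => u ((bubble f s₁ ε).map z)) ![angleToS f s₀ s₁ σ, θ] =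
      (H.restrict h₁ hu ε).Gs σ θ / (phiF f s₁ * cos σ / dphi f (angleToS f s₀ s₁ σ)) := by
    have hcurve : HasDerivAt (fun t => (bubble f s₁ ε).map
        (Function.update ![angleToS f s₀ s₁ σ, θ] 0 t))
        ![1, 0, ((ε : ℤ) : ℝ) * profileSlope f s₁ (angleToS f s₀ s₁ σ)]
        (angleToS f s₀ s₁ σ) := by
      refine hasDerivAt_pi.2 fun i => ?_
      fin_cases i
      · simpa [bubble] using hasDerivAt_id' (angleToS f s₀ s₁ σ)
      · simpa [bubble] using hasDerivAt_const (angleToS f s₀ s₁ σ) θ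
      · simpa [bubble] using hU.self_of_nhds.const_mul ((ε : ℤ) : ℝ)
    have h := (hF.comp_hasDerivAt_of_eq (angleToS f s₀ s₁ σ) hcurve
      (congrArg (bubble f s₁ ε).map (Function.update_eq_self (0 : Fin 2)
        ![angleToS f s₀ s₁ σ, θ]).symm)).deriv
    -- The tangent ∂_σ is ds/dσ times the tangent ∂_s of the graph; dividing is allowed because cos
    -- σ > 0 inside.
    have hvec : (![phiF f s₁ * cos σ / dphi f (angleToS f s₀ s₁ σ), 0,
        ((ε : ℤ) : ℝ) * -(phiF f s₁ * sin σ / dphi f (angleToS f s₀ s₁ σ))] : Fin 3 → ℝ) =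
        (phiF f s₁ * cos σ / dphi f (angleToS f s₀ s₁ σ)) •
          ![1, 0, ((ε : ℤ) : ℝ) * profileSlope f s₁ (angleToS f s₀ s₁ σ)] := by
      rw [H.profileSlope_angleToS h₁ hσ]
      ext i
      fin_cases i <;> simp
      field_simp
    rw [restrict]
    simp only
    rw [hvec, map_smul, smul_eq_mul, mul_div_cancel_left₀ _ (by positivity), ← h]
    rfl
  have hp1 : partialDeriv 1 (fun z => u ((bubble f s₁ ε).map z)) ![angleToS f s₀ s₁ σ, θ] =
      (H.restrict h₁ hu ε).Gt σ θ := by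
    have hcurve : HasDerivAt (fun t => (bubble f s₁ ε).map
        (Function.update ![angleToS f s₀ s₁ σ, θ] 1 t)) ![0, 1, 0] θ := by
      refine hasDerivAt_pi.2 fun i => ?_
      fin_cases i
      · simpa [bubble] using hasDerivAt_const θ (angleToS f s₀ s₁ σ)
      · simpa [bubble] using hasDerivAt_id' θ
      · simpa [bubble] using
          hasDerivAt_const θ (((ε : ℤ) : ℝ) * profile f s₁ (angleToS f s₀ s₁ σ))
    exact (hF.comp_hasDerivAt_of_eq θ hcurve
      (congrArg (bubble f s₁ ε).map (Function.update_eq_self (1 : Fin 2)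
        ![angleToS f s₀ s₁ σ, θ]).symm)).deriv
  have harea := H.areaDensity_angle h₁ hσ hc ε θ
  rw [mul_left_comm, harea, bubble_gradNormSq (p := profileSlope f s₁)
    (q := ![angleToS f s₀ s₁ σ, θ]) hc.ne' hf hU.self_of_nhds, hp0, hp1,
    bubble_jacobiPotential (p := profileSlope f s₁) (q := ![angleToS f s₀ s₁ σ, θ]) hc.ne' hf
      (by
        filter_upwards [Ioo_mem_nhds hm.1 hm.2] with t ht using H.differentiableAt ht)
      hU (H.hasDerivAt_profileSlope h₁ hσ), hmap]
  simp only [Matrix.cons_val_zero, H.one_add_profileSlope_sq h₁ hσ, ZeroModeData.V, zeroModeData]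
  rw [H.profileSlope_angleToS h₁ hσ]
  have hG : (H.restrict h₁ hu ε).G σ θ = u (anglePoint f s₀ s₁ ε σ θ) := rfl
  have hlog : (fun t => deriv f t / f t) = logSlope f := rfl
  rw [hG, hlog]
  field_simp

theorem continuous_angularCoeff {c : ℝ} (hc : 0 < c) :
    Continuous fun x => (H.zeroModeData h₁).T x / (c ^ 2 * f (angleToS f s₀ s₁ x) ^ 2) := by
  have h1 := H.continuous_comp_angleToS h₁ H.smooth.continuousOn
  exact (H.zeroModeData h₁).continuous_T.div (continuous_const.mul (h1.pow 2))
    fun σ => (mul_pos (pow_pos hc 2) (pow_pos (H.pos _ (H.angleToS_mem h₁ σ)) 2)).ne'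

theorem surfaceIntegral_angle {c : ℝ} (hc : 0 < c) :
    surfaceIntegral (tubeMetric f c) (bubble f s₁) (fun ε q => u ((bubble f s₁ ε).map q)) =
      c * ((∫ x in (-(π / 2))..(π / 2), ∫ t in (0 : ℝ)..(2 * π),
          (H.zeroModeData h₁).T x * (H.restrict h₁ hu 1).G x t) +
        ∫ x in (-(π / 2))..(π / 2), ∫ t in (0 : ℝ)..(2 * π),
          (H.zeroModeData h₁).T x * (H.restrict h₁ hu (-1)).G x t) := by
  have h : ∀ ε : ℤˣ, ∫ q in (bubble f s₁ ε).dom, u ((bubble f s₁ ε).map q) *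
      (bubble f s₁ ε).areaDensity (tubeMetric f c) q =
      ∫ x in (-(π / 2))..(π / 2), ∫ t in (0 : ℝ)..(2 * π),
        c * ((H.zeroModeData h₁).T x * (H.restrict h₁ hu ε).G x t) := fun ε => by
    refine H.setIntegral_bubble_dom h₁ ε ?_ fun σ hσ θ _ => ?_
    · have h1 := (H.zeroModeData h₁).continuous_T.comp (continuous_fst (X := ℝ) (Y := ℝ))
      exact continuous_const.mul (h1.mul (H.restrict h₁ hu ε).continuous_G)
    · rw [mul_left_comm, H.areaDensity_angle h₁ hσ hc, H.bubble_map_angle h₁ hσ]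
      simp only [restrict]
      ring
  have hne : (1 : ℤˣ) ≠ -1 := by decide
  rw [surfaceIntegral, UnitsInt.univ, Finset.sum_pair hne, h, h]
  simp only [intervalIntegral.integral_const_mul, mul_add]

theorem indexForm_angle {c : ℝ} (hc : 0 < c) :
    indexForm (tubeMetric f c) (bubble f s₁) u =
      c * ((∫ x in (-(π / 2))..(π / 2), (H.zeroModeData h₁).circleIndex
          (fun x => (H.zeroModeData h₁).T x / (c ^ 2 * f (angleToS f s₀ s₁ x) ^ 2))
          (H.restrict h₁ hu 1) x) +
        ∫ x in (-(π / 2))..(π / 2), (H.zeroModeData h₁).circleIndex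
          (fun x => (H.zeroModeData h₁).T x / (c ^ 2 * f (angleToS f s₀ s₁ x) ^ 2))
          (H.restrict h₁ hu (-1)) x) := by
  have h : ∀ ε : ℤˣ, ∫ q in (bubble f s₁ ε).dom,
      ((bubble f s₁ ε).gradNormSq (tubeMetric f c) u q +
        (bubble f s₁ ε).jacobiPotential (tubeMetric f c) q * u ((bubble f s₁ ε).map q) ^ 2) *
      (bubble f s₁ ε).areaDensity (tubeMetric f c) q =
      ∫ x in (-(π / 2))..(π / 2), ∫ t in (0 : ℝ)..(2 * π),
        c * ((H.zeroModeData h₁).A x * (H.restrict h₁ hu ε).Gs x t ^ 2 +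
        (H.zeroModeData h₁).T x / (c ^ 2 * f (angleToS f s₀ s₁ x) ^ 2) *
          (H.restrict h₁ hu ε).Gt x t ^ 2 +
        (H.zeroModeData h₁).V x * (H.restrict h₁ hu ε).G x t ^ 2) := fun ε => by
    refine H.setIntegral_bubble_dom h₁ ε ?_ fun σ hσ θ _ => H.index_angle h₁ hu hσ hc ε θ
    have hA := (H.zeroModeData h₁).continuous_A.comp (continuous_fst (X := ℝ) (Y := ℝ))
    have hV := (H.zeroModeData h₁).continuous_V.comp (continuous_fst (X := ℝ) (Y := ℝ))
    have hK := (H.continuous_angularCoeff h₁ hc).comp (continuous_fst (X := ℝ) (Y := ℝ))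
    have hG := (H.restrict h₁ hu ε).continuous_G
    have hGs := (H.restrict h₁ hu ε).continuous_Gs
    have hGt := (H.restrict h₁ hu ε).continuous_Gt
    exact continuous_const.mul (((hA.mul (hGs.pow 2)).add (hK.mul (hGt.pow 2))).add
      (hV.mul (hG.pow 2)))
  have hne : (1 : ℤˣ) ≠ -1 := by decide
  rw [indexForm, surfaceIntegral, UnitsInt.univ, Finset.sum_pair hne, h, h]
  simp only [intervalIntegral.integral_const_mul, ZeroModeData.circleIndex]
  ring

/-- The e term only helps. Since A = T (φ'/Λ)² and the angular term is T / (2πcf)², the claim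
follows from φ' ≤ 1 and 2πcf < Λ. -/
theorem angular_add_V_pos {c : ℝ} (hc : 0 < c) {M : ℝ} (hM : ∀ s ∈ Ioo (-s₀) s₀, f s ≤ M)
    (hφ : 2 * π * M < phiF f s₁ / c) (x : ℝ) :
    0 < (H.zeroModeData h₁).T x / (c ^ 2 * f (angleToS f s₀ s₁ x) ^ 2) / (4 * π ^ 2) +
      (H.zeroModeData h₁).V x := by
  have hm := H.angleToS_mem h₁ x
  have hpi := Real.pi_pos
  have hf := H.pos _ hm
  have hd := H.dphi_pos hm
  have hd1 : dphi f (angleToS f s₀ s₁ x) ≤ 1 := by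
    have := H.phiF_mul_logSlope_nonneg hm
    unfold dphi
    linarith
  have hφ1 := H.phiF_pos h₁
  have hT := (H.zeroModeData h₁).T_pos x
  have hA : (H.zeroModeData h₁).A x = (H.zeroModeData h₁).T x *
      (dphi f (angleToS f s₀ s₁ x) / phiF f s₁) ^ 2 := by
    simp only [zeroModeData]
    field_simp
  have he : 0 ≤ (H.zeroModeData h₁).e x * sin x ^ 2 :=
    mul_nonneg ((H.zeroModeData h₁).e_pos x).le (sq_nonneg _)
  have h1 : 2 * π * c * f (angleToS f s₀ s₁ x) < phiF f s₁ := by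
    rw [lt_div_iff₀ hc] at hφ
    nlinarith [hM _ hm, mul_pos hpi hc]
  have h2 : (dphi f (angleToS f s₀ s₁ x) / phiF f s₁) ^ 2 <
      (1 / (2 * π * c * f (angleToS f s₀ s₁ x))) ^ 2 := by
    have h3 : dphi f (angleToS f s₀ s₁ x) / phiF f s₁ ≤ 1 / phiF f s₁ :=
      div_le_div_of_nonneg_right hd1 hφ1.le
    have h4 : 1 / phiF f s₁ < 1 / (2 * π * c * f (angleToS f s₀ s₁ x)) :=
      one_div_lt_one_div_of_lt (by positivity) h1
    exact pow_lt_pow_left₀ (h3.trans_lt h4) (by positivity) two_ne_zero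
  have h5 : (H.zeroModeData h₁).T x / (c ^ 2 * f (angleToS f s₀ s₁ x) ^ 2) / (4 * π ^ 2) =
      (H.zeroModeData h₁).T x * (1 / (2 * π * c * f (angleToS f s₀ s₁ x))) ^ 2 := by
    field_simp
    norm_num
  rw [ZeroModeData.V, hA, h5]
  have := mul_lt_mul_of_pos_left h2 hT
  linarith

/-- The bubbles are stable if the parameter circles are short compared to `φ(s₁)`. -/
theorem isStableBubble {I : Set ℝ} (hI : Ioo (-s₀) s₀ ⊆ I) {c : ℝ} (hc : 0 < c) {M : ℝ}
    (hM : ∀ s ∈ Ioo (-s₀) s₀, f s ≤ M) (hφ : 2 * π * M < phiF f s₁ / c) :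
    IsStableBubble I f c s₁ := by
  intro u hu hmean hne
  have hu' : ContDiffOn ℝ ∞ u {x | x 0 ∈ Ioo (-s₀) s₀} := hu.1.mono fun x hx => hI hx
  rw [H.surfaceIntegral_angle h₁ hu' hc] at hmean
  rw [H.indexForm_angle h₁ hu' hc]
  -- The two halves are glued along the circles of height zero, so the restrictions of u agree
  -- there.
  have hends : ∀ σ, angleToY f s₀ s₁ σ = 0 → ∀ t,
      (H.restrict h₁ hu' 1).G σ t = (H.restrict h₁ hu' (-1)).G σ t := fun σ hσ t => by
    simp [restrict, anglePoint, hσ]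
  refine mul_pos hc ((H.zeroModeData h₁).index_pos (H.continuous_angularCoeff h₁ hc)
    (fun x => div_nonneg ((H.zeroModeData h₁).T_pos x).le (by positivity))
    (H.angular_add_V_pos h₁ hc hM hφ) _ _ (hends _ (H.angleToY_neg_pi_div_two h₁))
    (hends _ (by simp [angleToY])) ((mul_eq_zero.1 hmean).resolve_left hc.ne') ?_)
  -- In the angle coordinate ⟨∂_y, ν⟩ is ε cos σ, so the null pairs (a cos, -a cos) are exactly the
  -- excluded multiples.
  rintro ⟨a, ha⟩
  refine hne ⟨a, fun ε q hq => ?_⟩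
  have hσ := H.arcsin_mem_Ioo h₁ hq.1
  set σ := arcsin (phiF f (q 0) / phiF f s₁) with hσdef
  have hS : angleToS f s₀ s₁ σ = q 0 := H.angleToS_arcsin h₁ (Ioo_subset_Icc_self hq.1)
  have hf := (H.pos _ (H.angleToS_mem h₁ σ)).ne'
  have hq' : q = ![angleToS f s₀ s₁ σ, q 1] := by
    rw [hS]
    ext i
    fin_cases i <;> simp
  have hU := H.hasDerivAt_profile h₁ hq.1
  rw [bubble_partialY_inner hc.ne' (by rwa [← hS]) hU, ← hS, H.sqrt_one_add_profileSlope_sq h₁ hσ,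
    hq', H.bubble_map_angle h₁ hσ]
  obtain ⟨h1, h2⟩ := ha σ (Ioo_subset_Icc_self hσ) (q 1) (Ioo_subset_Icc_self hq.2)
  simp only [restrict] at h1 h2
  rcases Int.units_eq_one_or ε with rfl | rfl
  · rw [h1]; simp
  · rw [h2]; simp

end ConvexTube

end

theorem theorem10p1
    (I : Set ℝ) (hI_open : IsOpen I) (hI_conn : I.OrdConnected) (hI_symm : ∀ s ∈ I, -s ∈ I)
    (f : ℝ → ℝ) (hf_smooth : ContDiffOn ℝ ∞ f I) (hf_pos : ∀ s ∈ I, 0 < f s)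
    (hf_even : ∀ s ∈ I, f (-s) = f s)
    (s₀ : ℝ) (hs₀ : 0 < s₀)
    (hF_neg : ∀ s ∈ Set.Ioo 0 s₀, deriv (deriv (fun t => Real.log (primF f t))) s < 0)
    (hF_pos : ∃ δ > 0, Set.Ioo s₀ (s₀ + δ) ⊆ I ∧
      ∀ s ∈ Set.Ioo s₀ (s₀ + δ), 0 < deriv (deriv (fun t => Real.log (primF f t))) s)
    (hf_log : ∀ s ∈ Set.Ioo (-s₀) s₀, 0 < deriv (deriv (fun t => Real.log (f t))) s) :
    ∃ β : ℝ, 0 < β ∧ ∀ c : ℝ, 0 < c → ∀ s₁ ∈ Set.Ioo 0 s₀,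
      phiF f s₁ / c > β → IsStableBubble I f c s₁ := by
  obtain ⟨δ, hδ, hδI, -⟩ := hF_pos
  -- A point of I beyond s₀ and its mirror image enclose [-s₀, s₀], so f is bounded on this compact
  -- interval, uniformly in s₁.
  have hmem : s₀ + δ / 2 ∈ I := hδI ⟨by linarith, by linarith⟩
  have hIcc : Set.Icc (-s₀) s₀ ⊆ I := fun x hx =>
    hI_conn.out (hI_symm _ hmem) hmem ⟨by linarith [hx.1], by linarith [hx.2]⟩
  have hIoo : Set.Ioo (-s₀) s₀ ⊆ I := Set.Ioo_subset_Icc_self.trans hIcc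
  have H : ConvexTube f s₀ := ⟨hs₀, hf_smooth.mono hIoo, fun s hs => hf_pos s (hIoo hs),
    fun s hs => hf_even s (hIoo hs), hF_neg, hf_log⟩
  obtain ⟨M, hM⟩ := isCompact_Icc.exists_bound_of_continuousOn (hf_smooth.continuousOn.mono hIcc)
  have hM' : ∀ s ∈ Set.Ioo (-s₀) s₀, f s ≤ M := fun s hs =>
    (le_abs_self _).trans (hM s (Set.Ioo_subset_Icc_self hs))
  have hM0 : 0 < M := (H.pos 0 H.zero_mem).trans_le (hM' 0 H.zero_mem)
  exact ⟨2 * Real.pi * M, by positivity, fun c hc s₁ hs₁ hφ =>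
    H.isStableBubble hs₁ hIoo hc hM' hφ⟩
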